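/- Let $H(2,1)$ be the group of real matrices $$\begin{pmatrix}1&x_1&x_2&z\\0&1&0&y_1\\0&0&1&y_2\\0&0&0&1\end{pmatrix},$$ let $\Gamma(2,1)$ be its subgroup of matrices with integer entries, and let $N(2,1)=\Gamma(2,1)\backslash H(2,1)$, a compact nilmanifold that is a principal $S^1$-bundle over $T^4$ via $(x_1,y_1,x_2,y_2,z)\mapsto(x_1,y_1,x_2,y_2)$. For $(a,b,c)\in\mathbb R^3\setminus\{0\}$ put $r=a^2+b^2+c^2$ and take the following left-invariant coframe on $H(2,1)$. If $(a,b)\neq(0,0)$, $$e^1=r\,dx_1,\quad e^2=a\,dy_1+b\Big(1+\tfrac{c^2}{a^2+b^2}\Big)dx_2-ac\,dy_2,\quad e^3=b\,dy_1-a\Big(1+\tfrac{c^2}{a^2+b^2}\Big)dx_2-bc\,dy_2,$$ $$e^4=c\,dy_1+(a^2+b^2)\,dy_2,\quad e^5=r^2(x_1dy_1+x_2dy_2-dz);$$ if $a=b=0$, $e^1=dx_1$, $e^2=dy_2$, $e^3=dx_2$, $e^4=dy_1$, $e^5=c\,(x_1dy_1+x_2dy_2-dz)$. In both cases $de^1=\dots=de^4=0$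 and $de^5=a(e^{12}-e^{34})+b(e^{13}+e^{24})+c(e^{14}-e^{23})$, and the coframe descends to $N(2,1)$. Let $N(2,1)_{a,b,c}$ be $N(2,1)$ with the metric $g=\sum_i e^i\otimes e^i$ and the $SU(2)$-structure $$\eta=e^5,\quad F_1=e^{12}+e^{34},\quad F_2=e^{13}+e^{42},\quad F_3=e^{14}+e^{23},$$ which satisfies $dF_1=dF_2=dF_3=0$ and $*_{\mathbb H}d\eta=-d\eta$ on $\mathbb H=\ker\eta$. Let $T=\eta\wedge d\eta$, let $\nabla^g$ be the Levi-Civita connection and $\nabla^+=\nabla^g+\frac12T$ the torsion connection, the metric connection with torsion $T$, for which $\eta,F_1,F_2,F_3$ are parallel. For $\lambda,\mu,\tau\in\mathbb R$ let $A=A_{\lambda,\mu,\tau}$ be the linear connection whose non-zero connection forms in this frame ($\nabla_XE_j=\sum_i\sigma^i_j(X)E_i$) are given by $\sigma^i_j=-\sigma^j_i$ and $$\sigma^1_2=-\sigma^3_4=-\lambda e^5,\quad \sigma^1_3=\sigma^2_4=-\mu e^5,\quad \sigma^1_4=-\sigma^2_3=-\tau e^5.$$ It is a metric connection and an $SU(2)$-instanton: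 its curvature satisfies $\Omega(\psi E_k,\psi E_l)=\Omega(E_k,E_l)$ and $\sum_k\Omega(E_k,\psi E_k)=0$, where $g(X,\psi Y)=F_1(X,Y)$. For a connection with curvature forms $\Omega^i_j$ put $p_1=\frac1{8\pi^2}\sum_{i<j}\Omega^i_j\wedge\Omega^i_j$. **Theorem.** Let $(\lambda,\mu,\tau)\neq(0,0,0)$ and $\lambda^2+\mu^2+\tau^2<a^2+b^2+c^2$. Then $$dT=2\pi^2\alpha'\big(p_1(\nabla^+)-p_1(A)\big),\qquad \alpha'=\frac{2}{a^2+b^2+c^2-\lambda^2-\mu^2-\tau^2}>0.$$ Moreover $N(2,1)_{a,b,c}$ with nowhere vanishing flux $H=T$, any constant dilaton $\phi$, gauge connection $A$ and curvature term $R$ the curvature of $\nabla^+$ is a compact solution of 1. the supersymmetry equations: there is a smooth nowhere vanishing spinor field $\epsilon$ on $N(2,1)$, for the spin structure given by the frame, with $\nabla^+\epsilon=0$, $(d\phi-\frac12H)\cdot\epsilon=0$ and $F^A\cdot\epsilon=0$; 2. the anomaly cancellation $dH=\frac{\alpha'}4\,8\pi^2\big(p_1(\nabla^+)-p_1(A)\big)$;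 3. the equations of motion $$Ric^g_{ij}-\tfrac14H_{imn}H_{jmn}+2\nabla^g_i\nabla^g_j\phi-\tfrac{\alpha'}4\sum_m\sum_{n<s}\big[(F^A)_{imns}(F^A)_{jmns}-R_{imns}R_{jmns}\big]=0,$$ $$\nabla^g_i\big(e^{-2\phi}H_{ijk}\big)=0,\qquad \nabla^+_i\big(e^{-2\phi}(F^A)_{ij}\big)=0,$$ in an orthonormal frame, where $i,m$ (resp. $j,m$) are the form indices of the curvatures, $n,s$ their endomorphism indices, and $\nabla^+$ in the last equation is coupled to $A$ on the endomorphism indices. In the coordinates $(x_1,y_1,x_2,y_2,z)$ the metric is * if $(a,b)\neq(0,0)$: $g=r^2(dx_1)^2+\frac{r^2}{a^2+b^2}(dx_2)^2+r(dy_1)^2+r(a^2+b^2)(dy_2)^2+r^4(x_1dy_1+x_2dy_2-dz)^2$; * if $a=b=0$: $g=(dx_1)^2+(dx_2)^2+(dy_1)^2+(dy_2)^2+c^2(x_1dy_1+x_2dy_2-dz)^2$. -/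

import Mathlib

open scoped Manifold ContDiff Topology

noncomputable section

namespace Heterotic

/-! ## The group `H(2,1)`, the lattice `Γ(2,1)` and the nilmanifold `N(2,1) = Γ(2,1) \ H(2,1)` -/

/-- The space of global coordinates `(x₁, y₁, x₂, y₂, z)` (indices `0, 1, 2, 3, 4`). -/
abbrev E5 : Type := Fin 5 → ℝ

/-- The matrix with coordinates `p = (x₁, y₁, x₂, y₂, z)`. -/
def heisMatrix (p : E5) : Matrix (Fin 4) (Fin 4) ℝ :=
  !![1, p 0, p 2, p 4;
     0, 1, 0, p 1;
     0, 0, 1, p 3;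
     0, 0, 0, 1]

def heisMul (p q : E5) : E5 :=
  ![p 0 + q 0, p 1 + q 1, p 2 + q 2, p 3 + q 3, p 4 + q 4 + p 0 * q 1 + p 2 * q 3]

def heisInv (p : E5) : E5 :=
  ![-p 0, -p 1, -p 2, -p 3, -p 4 + p 0 * p 1 + p 2 * p 3]

theorem heisMatrix_mul (p q : E5) : heisMatrix p * heisMatrix q = heisMatrix (heisMul p q) := by
  ext i j
  fin_cases i <;> fin_cases j <;>
    simp [heisMatrix, heisMul, Matrix.mul_apply, Fin.sum_univ_four] <;> ring

theorem heisMatrix_zero : heisMatrix 0 = 1 := by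
  ext i j
  fin_cases i <;> fin_cases j <;> simp [heisMatrix]

theorem heisMul_inv (p : E5) : heisMul p (heisInv p) = 0 := by
  ext i
  fin_cases i <;> (simp [heisMul, heisInv]; try ring)

theorem heisInv_mul (p : E5) : heisMul (heisInv p) p = 0 := by
  ext i
  fin_cases i <;> (simp [heisMul, heisInv]; try ring)

/-- The invertible matrix with coordinates `p`. -/
def heisUnit (p : E5) : GL (Fin 4) ℝ where
  val := heisMatrix p
  inv := heisMatrix (heisInv p)
  val_inv := by rw [heisMatrix_mul, heisMul_inv, heisMatrix_zero]
  inv_val := by rw [heisMatrix_mul, heisInv_mul, heisMatrix_zero]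

/-- The generalized Heisenberg group `H(2,1)`. -/
def H21 : Subgroup (GL (Fin 4) ℝ) where
  carrier := {A | ∃ p : E5, (A : Matrix (Fin 4) (Fin 4) ℝ) = heisMatrix p}
  mul_mem' := by
    rintro A B ⟨p, hp⟩ ⟨q, hq⟩
    exact ⟨heisMul p q, by rw [Units.val_mul, hp, hq, heisMatrix_mul]⟩
  one_mem' := ⟨0, by rw [Units.val_one, heisMatrix_zero]⟩
  inv_mem' := by
    rintro A ⟨p, hp⟩
    have hA : A = heisUnit p := Units.ext hp
    exact ⟨heisInv p, by rw [hA]; rfl⟩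

/-- The entries of an element of `H(2,1)`. -/
def entries (A : H21) : Matrix (Fin 4) (Fin 4) ℝ := ((A : GL (Fin 4) ℝ) : Matrix (Fin 4) (Fin 4) ℝ)

/-- The element of `H(2,1)` with given coordinates. -/
def ofCoord (p : E5) : H21 := ⟨heisUnit p, p, rfl⟩

/-- The coordinates `(x₁, y₁, x₂, y₂, z)` of an element of `H(2,1)`. -/
def coord (A : H21) : E5 :=
  ![entries A 0 1, entries A 1 3, entries A 0 2, entries A 2 3, entries A 0 3]

theorem coord_ofCoord (p : E5) : coord (ofCoord p) = p := by
  ext i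
  fin_cases i <;> simp [coord, entries, ofCoord, heisUnit, heisMatrix]

theorem exists_ofCoord (A : H21) : ∃ p, A = ofCoord p := by
  obtain ⟨A, p, hp⟩ := A
  exact ⟨p, Subtype.ext (Units.ext hp)⟩

theorem ofCoord_coord (A : H21) : ofCoord (coord A) = A := by
  obtain ⟨p, rfl⟩ := exists_ofCoord A
  rw [coord_ofCoord]

theorem ofCoord_mul (p q : E5) : ofCoord p * ofCoord q = ofCoord (heisMul p q) :=
  Subtype.ext (Units.ext (heisMatrix_mul p q))

theorem ofCoord_zero : ofCoord 0 = 1 := Subtype.ext (Units.ext heisMatrix_zero)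

theorem coord_mul (A B : H21) : coord (A * B) = heisMul (coord A) (coord B) := by
  obtain ⟨p, rfl⟩ := exists_ofCoord A
  obtain ⟨q, rfl⟩ := exists_ofCoord B
  rw [ofCoord_mul, coord_ofCoord, coord_ofCoord, coord_ofCoord]

theorem coord_inv (A : H21) : coord A⁻¹ = heisInv (coord A) := by
  obtain ⟨p, rfl⟩ := exists_ofCoord A
  have h : (ofCoord p)⁻¹ = ofCoord (heisInv p) :=
    inv_eq_of_mul_eq_one_right (by rw [ofCoord_mul, heisMul_inv, ofCoord_zero])
  rw [h, coord_ofCoord, coord_ofCoord]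

theorem entries_eq (A : H21) : entries A = heisMatrix (coord A) := by
  conv_lhs => rw [← ofCoord_coord A]
  rfl

theorem integral_iff (A : H21) :
    (∀ i j, ∃ n : ℤ, entries A i j = n) ↔ ∀ k, ∃ n : ℤ, coord A k = n := by
  constructor
  · intro h k
    fin_cases k
    · exact h 0 1
    · exact h 1 3
    · exact h 0 2
    · exact h 2 3
    · exact h 0 3
  · intro h i j
    choose n hn using h
    refine ⟨(!![1, n 0, n 2, n 4; 0, 1, 0, n 1; 0, 0, 1, n 3; 0, 0, 0, 1] :
      Matrix (Fin 4) (Fin 4) ℤ) i j, ?_⟩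
    rw [entries_eq]
    fin_cases i <;> fin_cases j <;> simp [heisMatrix, hn]

/-- The lattice `Γ(2,1)` of matrices with integer entries. -/
def Gamma21 : Subgroup H21 where
  carrier := {A | ∀ i j, ∃ n : ℤ, entries A i j = n}
  one_mem' := by
    intro i j
    refine ⟨if i = j then 1 else 0, ?_⟩
    simp [entries, Matrix.one_apply]
  mul_mem' := by
    intro A B hA hB i j
    choose m hm using hA
    choose n hn using hB
    refine ⟨∑ k, m i k * n k j, ?_⟩
    have : entries (A * B) = entries A * entries B := rfl
    simp [this, Matrix.mul_apply, hm, hn]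
  inv_mem' := by
    intro A hA
    have h := (integral_iff A).1 hA
    refine (integral_iff A⁻¹).2 ?_
    choose n hn using h
    rw [coord_inv]
    intro k
    fin_cases k
    · exact ⟨-n 0, by simp [heisInv, hn]⟩
    · exact ⟨-n 1, by simp [heisInv, hn]⟩
    · exact ⟨-n 2, by simp [heisInv, hn]⟩
    · exact ⟨-n 3, by simp [heisInv, hn]⟩
    · exact ⟨-n 4 + n 0 * n 1 + n 2 * n 3, by simp [heisInv, hn]⟩

/-- The nilmanifold `N(2,1) = Γ(2,1) \ H(2,1)` (orbits of left multiplication by `Γ(2,1)`),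
with the quotient topology. -/
abbrev N21 : Type := MulAction.orbitRel.Quotient Gamma21 H21

/-- The projection `ℝ⁵ ≅ H(2,1) → N(2,1)`, in the coordinates `(x₁, y₁, x₂, y₂, z)`. -/
def nilProj (p : E5) : N21 := Quotient.mk _ (ofCoord p)

/-- Left translation by `h`, in coordinates. -/
def leftTrans (h : H21) (p : E5) : E5 := coord (h * ofCoord p)

/-- The map `N(2,1) → T⁴` induced by `(x₁, y₁, x₂, y₂, z) ↦ (x₁, y₁, x₂, y₂)`. -/
def torusProj : N21 → (Fin 4 → UnitAddCircle) :=
  Quotient.lift (fun A : H21 => fun i : Fin 4 => ((coord A i.castSucc : ℝ) : UnitAddCircle)) (by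
    intro A B hAB
    obtain ⟨g, hg⟩ := MulAction.orbitRel_apply.1 hAB
    have hg' : (g : H21) * B = A := hg
    obtain ⟨n, hn⟩ : ∃ n : Fin 5 → ℤ, ∀ k, coord (g : H21) k = n k := by
      have := (integral_iff (g : H21)).1 g.2
      choose n hn using this
      exact ⟨n, hn⟩
    funext i
    have h : coord A i.castSucc = n i.castSucc + coord B i.castSucc := by
      rw [← hg', coord_mul, ← hn]
      fin_cases i <;> simp [heisMul]
    change ((coord A i.castSucc : ℝ) : UnitAddCircle) = ((coord B i.castSucc : ℝ) : UnitAddCircle)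
    rw [h, AddCircle.coe_add]
    have h0 : (((n i.castSucc : ℤ) : ℝ) : UnitAddCircle) = 0 := by
      rw [AddCircle.coe_eq_zero_iff]
      exact ⟨n i.castSucc, by simp⟩
    rw [h0, zero_add])

/-- `π : X → B` is a principal circle bundle: the circle `ℝ/ℤ` acts continuously on `X` and `π` has
equivariant local trivializations. -/
def IsPrincipalCircleBundle {X B : Type*} [TopologicalSpace X] [TopologicalSpace B]
    (π : X → B) : Prop :=
  ∃ act : UnitAddCircle → X → X,
    (∀ x, act 0 x = x) ∧ (∀ s t x, act (s + t) x = act s (act t x)) ∧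
    Continuous (fun q : UnitAddCircle × X => act q.1 q.2) ∧
    (∀ t x, π (act t x) = π x) ∧
    ∀ b, ∃ e : Bundle.Trivialization UnitAddCircle π, b ∈ e.baseSet ∧
      ∀ t x, π x ∈ e.baseSet → (e (act t x)).2 = t + (e x).2

/-! ## Differential forms -/

/-- Differential `k`-forms on the coordinate space. -/
abbrev Form (k : ℕ) : Type := E5 → E5 [⋀^Fin k]→L[ℝ] ℝ

/-- The multilinear map `(v₁, …, vₖ₊ₗ) ↦ α(v₁, …, vₖ) β(vₖ₊₁, …, vₖ₊ₗ)`. -/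
def tensorMul {k l : ℕ} (α : E5 [⋀^Fin k]→L[ℝ] ℝ) (β : E5 [⋀^Fin l]→L[ℝ] ℝ) :
    ContinuousMultilinearMap ℝ (fun _ : Fin (k + l) => E5) ℝ where
  toMultilinearMap := (LinearMap.mul' ℝ ℝ).compMultilinearMap
    ((MultilinearMap.domCoprod α.toMultilinearMap β.toMultilinearMap).domDomCongr finSumFinEquiv)
  cont := by
    change Continuous fun v : Fin (k + l) → E5 =>
      α (fun i => v (finSumFinEquiv (Sum.inl i))) * β (fun i => v (finSumFinEquiv (Sum.inr i)))
    exact (α.cont.comp (by fun_prop)).mul (β.cont.comp (by fun_prop))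

theorem tensorMul_apply {k l : ℕ} (α : E5 [⋀^Fin k]→L[ℝ] ℝ) (β : E5 [⋀^Fin l]→L[ℝ] ℝ)
    (v : Fin (k + l) → E5) :
    tensorMul α β v = α (fun i => v (Fin.castAdd l i)) * β (fun i => v (Fin.natAdd k i)) := rfl

/-- The exterior product, normalized so that `(α ∧ β)(X, Y) = α(X) β(Y) - α(Y) β(X)` for 1-forms. -/
def wedge {k l : ℕ} (α : Form k) (β : Form l) : Form (k + l) := fun p =>
  ((k.factorial * l.factorial : ℕ) : ℝ)⁻¹ •
    ContinuousMultilinearMap.alternatization (tensorMul (α p) (β p))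

/-- The coordinate 1-forms `dx₁, dy₁, dx₂, dy₂, dz` (indices `0, 1, 2, 3, 4`). -/
def dcoord (i : Fin 5) : Form 1 := fun _ =>
  ContinuousAlternatingMap.ofSubsingleton ℝ E5 ℝ (0 : Fin 1) (ContinuousLinearMap.proj i)

/-- The 1-form `x₁ dy₁ + x₂ dy₂ - dz`. -/
def contactForm : Form 1 := fun p => p 0 • dcoord 1 p + p 2 • dcoord 3 p - dcoord 4 p

open Classical in
/-- The left-invariant coframe `e¹, …, e⁵` (indices `0, …, 4`) attached to `(a, b, c)`. -/
def coframe (a b c : ℝ) : Fin 5 → Form 1 :=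
  if a = 0 ∧ b = 0 then
    ![dcoord 0, dcoord 3, dcoord 2, dcoord 1, c • contactForm]
  else
    ![(a ^ 2 + b ^ 2 + c ^ 2) • dcoord 0,
      a • dcoord 1 + (b * (1 + c ^ 2 / (a ^ 2 + b ^ 2))) • dcoord 2 - (a * c) • dcoord 3,
      b • dcoord 1 - (a * (1 + c ^ 2 / (a ^ 2 + b ^ 2))) • dcoord 2 - (b * c) • dcoord 3,
      c • dcoord 1 + (a ^ 2 + b ^ 2) • dcoord 3,
      (a ^ 2 + b ^ 2 + c ^ 2) ^ 2 • contactForm]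

/-! ## Riemannian geometry in an orthonormal coframe `θ`

All indices below refer to the frame `E₁, …, E₅` dual to `θ = (e¹, …, e⁵)`, which is orthonormal for
`g = ∑ eⁱ ⊗ eⁱ`. -/

/-- The frame dual to a coframe (its components are the columns of the inverse of the matrix of the
components of the coframe). -/
def frame (θ : Fin 5 → Form 1) (i : Fin 5) : E5 → E5 := fun p k =>
  (Matrix.of fun r s : Fin 5 => θ r p ![Pi.single s 1])⁻¹ k i

/-- The metric `g = ∑ eⁱ ⊗ eⁱ`. -/
def metric (θ : Fin 5 → Form 1) (p u v : E5) : ℝ := ∑ i, θ i p ![u] * θ i p ![v]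

/-- Frame components `α(E_{I 0}, …, E_{I (k-1)})` of a form. -/
def comp (θ : Fin 5 → Form 1) {k : ℕ} (α : Form k) (I : Fin k → Fin 5) (p : E5) : ℝ :=
  α p fun j => frame θ (I j) p

/-- The matrix of 1-forms `w i j = wⁱⱼ` of a connection on a bundle with a global frame indexed by
`ι`, with `∇_X E_j = ∑ᵢ wⁱⱼ(X) Eᵢ`. -/
abbrev Conn (ι : Type) : Type := ι → ι → Form 1

/-- The curvature 2-forms `Ωⁱⱼ = dwⁱⱼ + ∑ₖ wⁱₖ ∧ wᵏⱼ`. -/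
def curvature {ι : Type} [Fintype ι] (w : Conn ι) (i j : ι) : Form 2 :=
  extDeriv (w i j) + ∑ k, wedge (w i k) (w k j)

/-- The first Pontrjagin form `p₁ = (1 / 8π²) ∑_{i<j} Ωⁱⱼ ∧ Ωⁱⱼ`. -/
def pontrjagin (w : Conn (Fin 5)) : Form 4 :=
  (1 / (8 * Real.pi ^ 2)) •
    ∑ i, ∑ j ∈ Finset.Ioi i, wedge (curvature w i j) (curvature w i j)

/-- The Levi-Civita connection of `∑ eⁱ ⊗ eⁱ`, by the Koszul formula
`2 g(∇_{E_k} E_j, Eᵢ) = g([E_k, E_j], Eᵢ) - g([E_j, Eᵢ], E_k) + g([Eᵢ, E_k], E_j)`. -/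
def leviCivita (θ : Fin 5 → Form 1) : Conn (Fin 5) := fun i j p =>
  ∑ k, ((1 / 2 : ℝ) *
    (θ i p ![VectorField.lieBracket ℝ (frame θ k) (frame θ j) p]
      - θ k p ![VectorField.lieBracket ℝ (frame θ j) (frame θ i) p]
      + θ j p ![VectorField.lieBracket ℝ (frame θ i) (frame θ k) p])) • θ k p

/-- The connection `∇⁺ = ∇ᵍ + ½ H`, i.e. `g(∇⁺_X Y, Z) = g(∇ᵍ_X Y, Z) + ½ H(X, Y, Z)`. -/
def plusConn (θ : Fin 5 → Form 1) (H : Form 3) : Conn (Fin 5) := fun i j p =>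
  leviCivita θ i j p + ∑ k, ((1 / 2 : ℝ) * comp θ H ![k, j, i] p) • θ k p

/-- `∇` is a metric connection whose torsion is the 3-form `T`: the connection forms are
skew-symmetric and `g(∇_X Y - ∇_Y X - [X, Y], Eᵢ) = T(X, Y, Eᵢ)`, where the left-hand side is
`(deⁱ + ∑ⱼ wⁱⱼ ∧ eʲ)(X, Y)`. -/
def IsMetricWithTorsion (θ : Fin 5 → Form 1) (w : Conn (Fin 5)) (T : Form 3) : Prop :=
  (∀ i j, w i j = -w j i) ∧
  ∀ i p u v, (extDeriv (θ i) + ∑ j, wedge (w i j) (θ j) : Form 2) p ![u, v] =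
    T p ![u, v, frame θ i p]

/-- Derivative of a function along `E_m`. -/
def frameDeriv (θ : Fin 5 → Form 1) (m : Fin 5) (f : E5 → ℝ) (p : E5) : ℝ :=
  fderiv ℝ f p (frame θ m p)

/-- Components `(∇_{E_m} P)_I` of the covariant derivative of the covariant tensor with frame
components `P`. -/
def covDeriv (θ : Fin 5 → Form 1) (w : Conn (Fin 5)) {k : ℕ} (P : (Fin k → Fin 5) → E5 → ℝ)
    (m : Fin 5) (I : Fin k → Fin 5) (p : E5) : ℝ :=
  frameDeriv θ m (P I) p
    - ∑ t, ∑ s, w s (I t) p ![frame θ m p] * P (Function.update I t s) p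

/-- The form `α` is parallel. -/
def IsParallel (θ : Fin 5 → Form 1) (w : Conn (Fin 5)) {k : ℕ} (α : Form k) : Prop :=
  ∀ m I p, covDeriv θ w (comp θ α) m I p = 0

/-- The Ricci tensor `Ric(E_m, E_n) = ∑ᵢ g(R(Eᵢ, E_m) E_n, Eᵢ)`. -/
def ricci (θ : Fin 5 → Form 1) (w : Conn (Fin 5)) (m n : Fin 5) (p : E5) : ℝ :=
  ∑ i, comp θ (curvature w i n) ![i, m] p

/-! ## `SU(2)`-structures and instantons -/

/-- The 2-form `e^{ij}`. -/
def e2 (θ : Fin 5 → Form 1) (i j : Fin 5) : Form 2 := wedge (θ i) (θ j)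

/-- `F₁ = e¹² + e³⁴`, `F₂ = e¹³ + e⁴²`, `F₃ = e¹⁴ + e²³`. -/
def su2Forms (θ : Fin 5 → Form 1) : Fin 3 → Form 2 :=
  ![e2 θ 0 1 + e2 θ 2 3, e2 θ 0 2 + e2 θ 3 1, e2 θ 0 3 + e2 θ 1 2]

/-- `(η, F₁, F₂, F₃)` is an `SU(2)`-structure. -/
def IsSU2Structure (η : Form 1) (F : Fin 3 → Form 2) : Prop :=
  (∃ v : Form 4, (∀ r s, (wedge (F r) (F s) : Form 4) = if r = s then v else 0) ∧
    ∀ p, wedge v η p ≠ 0) ∧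
  ∀ p X Y : E5, (∀ Z, F 0 p ![X, Z] = F 1 p ![Y, Z]) → 0 ≤ F 2 p ![X, Y]

/-- `β` is horizontal and `*_ℍ β = -β`, for the Hodge operator of `ℍ = ker e⁵` with the oriented
orthonormal frame `E₁, E₂, E₃, E₄`. -/
def IsHorizontalASD (θ : Fin 5 → Form 1) (β : Form 2) : Prop :=
  ∀ p, (∀ j, comp θ β ![4, j] p = 0) ∧
    comp θ β ![0, 1] p = -comp θ β ![2, 3] p ∧
    comp θ β ![0, 2] p = -comp θ β ![3, 1] p ∧
    comp θ β ![0, 3] p = -comp θ β ![1, 2] p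

/-- The endomorphism `ψ` with `g(X, ψ Y) = F(X, Y)`. -/
def psi (θ : Fin 5 → Form 1) (F : Form 2) (p Y : E5) : E5 :=
  ∑ k, F p ![frame θ k p, Y] • frame θ k p

/-- The connection is an `SU(2)`-instanton:
`Ω(ψ E_k, ψ E_l) = Ω(E_k, E_l)` and `∑ₖ Ω(E_k, ψ E_k) = 0`. -/
def IsInstanton (θ : Fin 5 → Form 1) (F : Form 2) {ι : Type} [Fintype ι] (A : Conn ι) : Prop :=
  ∀ (m n : ι) (p : E5),
    (∀ k l, curvature A m n p ![psi θ F p (frame θ k p), psi θ F p (frame θ l p)] =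
      curvature A m n p ![frame θ k p, frame θ l p]) ∧
    ∑ k, curvature A m n p ![frame θ k p, psi θ F p (frame θ k p)] = 0

/-- The torsion 3-form `T = η ∧ dη` with `η = e⁵`. -/
def torsionForm (θ : Fin 5 → Form 1) : Form 3 := wedge (θ 4) (extDeriv (θ 4))

/-- The linear connection `A_{l,m,t}`, given by its matrix of connection forms in the frame. -/
def instantonConn (θ : Fin 5 → Form 1) (l m t : ℝ) : Conn (Fin 5) := fun i j =>
  (!![0, -l, -m, -t, 0;
      l, 0, t, -m, 0;
      m, -t, 0, l, 0;
      t, m, -l, 0, 0;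
      0, 0, 0, 0, 0] : Matrix (Fin 5) (Fin 5) ℝ) i j • θ 4

/-! ## Spinors and the supersymmetry equations -/

/-- Clifford multiplication by `E₁, …, E₅` on a 4-dimensional complex spin module:
`E_i E_j + E_j E_i = -2 δ_ij`. -/
def IsCliffordRep (γ : Fin 5 → Matrix (Fin 4) (Fin 4) ℂ) : Prop :=
  ∀ i j, γ i * γ j + γ j * γ i = if i = j then (-2 : ℂ) • 1 else 0

/-- `∇_{E_m} s` for a spinor field `s`: the lift of the metric connection `w` to the spinor bundle
trivialized by the global orthonormal frame,
`∇_X s = X(s) + ¼ ∑_{i,j} g(∇_X E_i, E_j) E_i · E_j · s`. -/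
def spinorDeriv (θ : Fin 5 → Form 1) (γ : Fin 5 → Matrix (Fin 4) (Fin 4) ℂ) (w : Conn (Fin 5))
    (s : E5 → Fin 4 → ℂ) (m : Fin 5) (p : E5) : Fin 4 → ℂ :=
  fderiv ℝ s p (frame θ m p) +
    (1 / 4 : ℂ) • ∑ i, ∑ j, ((w j i p ![frame θ m p] : ℝ) : ℂ) • (γ i * γ j).mulVec (s p)

/-- Clifford action `H · s` of a 3-form on a spinor. -/
def cliff3 (θ : Fin 5 → Form 1) (γ : Fin 5 → Matrix (Fin 4) (Fin 4) ℂ) (H : Form 3) (p : E5)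
    (s : Fin 4 → ℂ) : Fin 4 → ℂ :=
  (1 / 6 : ℂ) • ∑ i, ∑ j, ∑ k, ((comp θ H ![i, j, k] p : ℝ) : ℂ) • (γ i * γ j * γ k).mulVec s

/-- Gravitino, dilatino and gaugino Killing spinor equations on `N(2,1)`, for the metric
`∑ eⁱ ⊗ eⁱ`, the flux `H`, the dilaton `φ` and the gauge connection `A`: there is a smooth nowhere
vanishing spinor field `ε` on `N(2,1)` with `∇⁺ε = 0`, `(dφ - ½ H) · ε = 0` and `F^A · ε = 0`.
Spinor fields and functions on `N(2,1)` are differentiated after composition with the covering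
`nilProj`. -/
def SupersymmetryEquations (θ : Fin 5 → Form 1) (γ : Fin 5 → Matrix (Fin 4) (Fin 4) ℂ)
    (H : Form 3) (φ : N21 → ℝ) {ι : Type} [Fintype ι] (A : Conn ι) : Prop :=
  ∃ ε : N21 → Fin 4 → ℂ,
    ContDiff ℝ ∞ (fun p => ε (nilProj p)) ∧ (∀ q, ε q ≠ 0) ∧
    ∀ p,
      (∀ m, spinorDeriv θ γ (plusConn θ H) (fun p => ε (nilProj p)) m p = 0) ∧
      (∑ m, ((frameDeriv θ m (fun p => φ (nilProj p)) p : ℝ) : ℂ) •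
          (γ m).mulVec (ε (nilProj p))
        - (1 / 2 : ℂ) • cliff3 θ γ H p (ε (nilProj p)) = 0) ∧
      ∀ a b : ι, ∑ m, ∑ n, ((comp θ (curvature A a b) ![m, n] p : ℝ) : ℂ) •
        (γ m * γ n).mulVec (ε (nilProj p)) = 0

/-- Anomaly cancellation: `dH = (α'/4) 8π² (p₁(∇) - p₁(A))`. -/
def AnomalyCancellation (H : Form 3) (α' : ℝ) (w A : Conn (Fin 5)) : Prop :=
  extDeriv H = (α' / 4 * (8 * Real.pi ^ 2)) • (pontrjagin w - pontrjagin A)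

/-- `∑_m Tr(Ω(E_i, E_m), Ω(E_j, E_m))`, where `Tr(S, S') = ∑_{n<s} Sⁿₛ S'ⁿₛ` is the trace
normalization of the first Pontrjagin form `8π² p₁ = Tr(Ω ∧ Ω)`. -/
def curvatureSquare (θ : Fin 5 → Form 1) (w : Conn (Fin 5)) (i j : Fin 5) (p : E5) : ℝ :=
  ∑ m, ∑ n, ∑ s ∈ Finset.Ioi n,
    comp θ (curvature w n s) ![i, m] p * comp θ (curvature w n s) ![j, m] p

/-- `Ricᵍ_ij - ¼ H_imn H_jmn + 2 ∇ᵍ_i ∇ᵍ_j φ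
  - (α'/4) (∑_m Tr(F^A_im, F^A_jm) - ∑_m Tr(R_im, R_jm)) = 0`,
with `R` the curvature of the connection `w`. -/
def EinsteinEquation (θ : Fin 5 → Form 1) (H : Form 3) (φ : N21 → ℝ) (α' : ℝ)
    (w A : Conn (Fin 5)) : Prop :=
  ∀ i j p,
    ricci θ (leviCivita θ) i j p
      - (1 / 4) * ∑ m, ∑ n, comp θ H ![i, m, n] p * comp θ H ![j, m, n] p
      + 2 * covDeriv θ (leviCivita θ)
          (fun I : Fin 1 → Fin 5 => frameDeriv θ (I 0) (fun p => φ (nilProj p))) i ![j] p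
      - α' / 4 * (curvatureSquare θ A i j p - curvatureSquare θ w i j p) = 0

/-- `∇ᵍ_i (e^{-2φ} H_ijk) = 0`. -/
def FluxEquation (θ : Fin 5 → Form 1) (H : Form 3) (φ : N21 → ℝ) : Prop :=
  ∀ j k p, ∑ i, covDeriv θ (leviCivita θ)
    (fun I p => Real.exp (-2 * φ (nilProj p)) * comp θ H I p) i ![i, j, k] p = 0

/-- `∇⁺_i (e^{-2φ} (F^A)_ij) = 0`, where the derivative of the `End(E)`-valued 2-form `F^A` is taken
with `∇⁺` on tangent indices and with `A` on bundle indices. -/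
def GaugeEquation (θ : Fin 5 → Form 1) (H : Form 3) (φ : N21 → ℝ) {ι : Type} [Fintype ι]
    (A : Conn ι) : Prop :=
  ∀ (j : Fin 5) (a b : ι) (p : E5), ∑ i,
    (covDeriv θ (plusConn θ H)
        (fun I p => Real.exp (-2 * φ (nilProj p)) * comp θ (curvature A a b) I p) i ![i, j] p
      + Real.exp (-2 * φ (nilProj p)) *
        ∑ c, (A a c p ![frame θ i p] * comp θ (curvature A c b) ![i, j] p
          - comp θ (curvature A a c) ![i, j] p * A c b p ![frame θ i p])) = 0

/-- The heterotic equations of motion, with curvature term `R` the curvature of `w`. -/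
def EquationsOfMotion (θ : Fin 5 → Form 1) (H : Form 3) (φ : N21 → ℝ) (α' : ℝ)
    (w A : Conn (Fin 5)) : Prop :=
  EinsteinEquation θ H φ α' w A ∧ FluxEquation θ H φ ∧ GaugeEquation θ H φ A

/-! ## The compact `SU(2)`-nilmanifold -/

/-- `N(2,1)` is a compact connected smooth manifold covered by `H(2,1) ≅ ℝ⁵` and a principal circle
bundle over `T⁴`, and the coframe `θ` is the pull-back of a coframe on `N(2,1)`. Every local
statement about `θ` on `ℝ⁵` is therefore a statement about `N(2,1)`. -/
def DescendsToCompactNilmanifold (θ : Fin 5 → Form 1) : Prop :=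
  CompactSpace N21 ∧ T2Space N21 ∧ ConnectedSpace N21 ∧ IsCoveringMap nilProj ∧
  IsPrincipalCircleBundle torusProj ∧
  ∃ _ : ChartedSpace E5 N21, IsManifold 𝓘(ℝ, E5) ∞ N21 ∧
    IsLocalDiffeomorph 𝓘(ℝ, E5) 𝓘(ℝ, E5) ∞ nilProj ∧
    ∃ eN : Fin 5 → (q : N21) → TangentSpace 𝓘(ℝ, E5) q →L[ℝ] ℝ,
      ∀ i p (u : E5), eN i (nilProj p) (mfderiv 𝓘(ℝ, E5) 𝓘(ℝ, E5) nilProj p u) = θ i p ![u]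

/-- `θ` is a smooth left-invariant coframe on `H(2,1)`, with dual frame `frame θ`. -/
def IsLeftInvariantCoframe (θ : Fin 5 → Form 1) : Prop :=
  (∀ i, ContDiff ℝ ∞ (θ i)) ∧
  (∀ i j p, θ i p ![frame θ j p] = if i = j then 1 else 0) ∧
  ∀ (h : H21) i p u, θ i (leftTrans h p) ![fderiv ℝ (leftTrans h) p u] = θ i p ![u]

/-- `de¹ = de² = de³ = de⁴ = 0` and
`de⁵ = a (e¹² - e³⁴) + b (e¹³ + e²⁴) + c (e¹⁴ - e²³)`. -/
def StructureEquations (θ : Fin 5 → Form 1) (a b c : ℝ) : Prop :=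
  (∀ i : Fin 5, i ≠ 4 → extDeriv (θ i) = 0) ∧
  extDeriv (θ 4) = a • (e2 θ 0 1 - e2 θ 2 3) + b • (e2 θ 0 2 + e2 θ 1 3)
    + c • (e2 θ 0 3 - e2 θ 1 2)

end Heterotic

end

open scoped Manifold ContDiff Topology

noncomputable section

namespace Heterotic

/-! Write `r = a² + b² + c²` and `s = λ² + μ² + τ²`. In the given frame all the geometry has
constant coefficients: `e¹, …, e⁴` are closed, and `dη` is a horizontal anti-self-dual 2-form with
constant skew matrix `asdMatrix a b c`.

The central fact is that `∇⁺` and `A` lie in one family. In the Koszul formula, adding half of `T =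
η ∧ dη` cancels every term not along `η`, so `∇⁺ = A_{a,b,c}` (`plusConn_eq_instantonConn`). The
connection forms of `A_{λ,μ,τ}` are all multiples of `η`, hence the quadratic part of the curvature
vanishes and `Ω` is a constant matrix times `dη` (`curvature_instantonConn`). This gives `p₁ =
s/(4π²) dη ∧ dη` for `A` and the same with `r` for `∇⁺`. As `dη` has constant coefficients, `dT = dη
∧ dη`, and the anomaly equation becomes `α'(r - s) = 2`.

Anti-self-duality yields the rest of the local statements. The matrices `asdMatrix` annihilate the
self-dual forms `F₁, F₂, F₃`, which are therefore `∇⁺`-parallel. A spinor of negative chirality for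
the horizontal volume element is killed by `dη` (`IsCliffordRep.asd_mulVec`), so one that is
constant in the frame solves all three Killing spinor equations. The Einstein equation is diagonal:
trivial along `η`, and horizontally the same condition `α'(r - s) = 2`. These arguments use only the
properties collected in `IsContactCoframe`.

Globally, the lattice is discrete and acts by left translations, so `nilProj` is a covering whose
local inverses serve as charts, with lattice translations as transition maps; left-invariant forms
descend. Translations in `z` are central and give the principal circle action over `T⁴`. -/

/-! ### Exterior products in low degree, evaluated on vectors. -/

theorem wedge_apply {k l : ℕ} (α : Form k) (β : Form l) (p : E5) (v : Fin (k + l) → E5) :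
    wedge α β p v = ((k.factorial * l.factorial : ℕ) : ℝ)⁻¹ *
      ∑ σ : Equiv.Perm (Fin (k + l)), ((Equiv.Perm.sign σ : ℤ) : ℝ) *
        (α p (fun i => v (σ (Fin.castAdd l i))) * β p (fun i => v (σ (Fin.natAdd k i)))) := by
  simp only [wedge, ContinuousAlternatingMap.smul_apply, smul_eq_mul,
    ContinuousMultilinearMap.alternatization_apply_apply]
  congr 1
  refine Finset.sum_congr rfl fun σ _ => ?_
  simp [tensorMul_apply, Units.smul_def]

/-- `decomposeFin` separates the image of `0` from a permutation of the rest and controls the sign;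
iterating it turns a signed sum over a small symmetric group into an explicit list. -/
theorem sum_perm_succ {n : ℕ} (f : Equiv.Perm (Fin (n + 1)) → ℝ) :
    ∑ σ, f σ = ∑ i : Fin (n + 1), ∑ τ : Equiv.Perm (Fin n),
      f (Equiv.Perm.decomposeFin.symm (i, τ)) := by
  rw [← Equiv.sum_comp Equiv.Perm.decomposeFin.symm, Fintype.sum_prod_type]

theorem vec_one {X : Type*} (f : Fin 1 → X) : f = ![f 0] := by
  ext i; fin_cases i; rfl

theorem vec_two {X : Type*} (f : Fin 2 → X) : f = ![f 0, f 1] := by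
  ext i; fin_cases i <;> rfl

theorem vec_three {X : Type*} (f : Fin 3 → X) : f = ![f 0, f 1, f 2] := by
  ext i; fin_cases i <;> rfl

theorem vec_four {X : Type*} (f : Fin 4 → X) : f = ![f 0, f 1, f 2, f 3] := by
  ext i; fin_cases i <;> rfl

theorem form_two_swap (β : E5 [⋀^Fin 2]→L[ℝ] ℝ) (u v : E5) : β ![u, v] = -β ![v, u] := by
  have := β.toAlternatingMap.map_swap ![v, u] (i := 0) (j := 1) (by decide)
  have h : (![v, u] ∘ Equiv.swap (0 : Fin 2) 1) = ![u, v] := by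
    ext i; fin_cases i <;> simp
  rw [h] at this
  exact this


theorem sum_perm_two (g : Fin 2 → Fin 2 → ℝ) :
    ∑ σ : Equiv.Perm (Fin 2), ((Equiv.Perm.sign σ : ℤ) : ℝ) * g (σ 0) (σ 1) =
      g 0 1 - g 1 0 := by
  have h1 : (1 : Fin 2) = Fin.succ 0 := rfl
  simp only [h1, sum_perm_succ, Fin.sum_univ_succ, Finset.univ_unique,
    Finset.sum_singleton, Equiv.Perm.decomposeFin.symm_sign,
    Equiv.Perm.decomposeFin_symm_apply_succ, Equiv.Perm.decomposeFin_symm_apply_zero]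
  simp
  ring

theorem sum_perm_three (g : Fin 3 → Fin 3 → Fin 3 → ℝ) :
    ∑ σ : Equiv.Perm (Fin 3), ((Equiv.Perm.sign σ : ℤ) : ℝ) * g (σ 0) (σ 1) (σ 2) =
      g 0 1 2 - g 0 2 1 - g 1 0 2 + g 1 2 0 + g 2 0 1 - g 2 1 0 := by
  have h1 : (1 : Fin 3) = Fin.succ 0 := rfl
  have h2 : (2 : Fin 3) = Fin.succ (Fin.succ 0) := rfl
  simp only [h1, h2, sum_perm_succ, Fin.sum_univ_succ, Finset.univ_unique,
    Finset.sum_singleton, Equiv.Perm.decomposeFin.symm_sign,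
    Equiv.Perm.decomposeFin_symm_apply_succ, Equiv.Perm.decomposeFin_symm_apply_zero]
  simp [Equiv.swap_apply_def, Fin.ext_iff]
  ring

theorem sum_perm_four (g : Fin 4 → Fin 4 → Fin 4 → Fin 4 → ℝ) :
    ∑ σ : Equiv.Perm (Fin 4), ((Equiv.Perm.sign σ : ℤ) : ℝ) * g (σ 0) (σ 1) (σ 2) (σ 3) =
      g 0 1 2 3 - g 0 1 3 2 - g 0 2 1 3 + g 0 2 3 1 + g 0 3 1 2 - g 0 3 2 1 - g 1 0 2 3 +
      g 1 0 3 2 + g 1 2 0 3 - g 1 2 3 0 - g 1 3 0 2 + g 1 3 2 0 + g 2 0 1 3 - g 2 0 3 1 -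
      g 2 1 0 3 + g 2 1 3 0 + g 2 3 0 1 - g 2 3 1 0 - g 3 0 1 2 + g 3 0 2 1 + g 3 1 0 2 -
      g 3 1 2 0 - g 3 2 0 1 + g 3 2 1 0 := by
  have h1 : (1 : Fin 4) = Fin.succ 0 := rfl
  have h2 : (2 : Fin 4) = Fin.succ (Fin.succ 0) := rfl
  have h3 : (3 : Fin 4) = Fin.succ (Fin.succ (Fin.succ 0)) := rfl
  simp only [h1, h2, h3, sum_perm_succ, Fin.sum_univ_succ, Finset.univ_unique,
    Finset.sum_singleton, Equiv.Perm.decomposeFin.symm_sign,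
    Equiv.Perm.decomposeFin_symm_apply_succ, Equiv.Perm.decomposeFin_symm_apply_zero]
  simp [Equiv.swap_apply_def, Fin.ext_iff]
  ring

/-- Only the 24 permutations fixing `4` survive. This is the sum met when a 4-form is wedged with a
1-form dual to the last frame vector. -/
theorem sum_perm_five (g : Fin 5 → Fin 5 → Fin 5 → Fin 5 → ℝ) :
    ∑ σ : Equiv.Perm (Fin 5), ((Equiv.Perm.sign σ : ℤ) : ℝ) *
      (g (σ 0) (σ 1) (σ 2) (σ 3) * if σ 4 = 4 then 1 else 0) =
      g 0 1 2 3 - g 0 1 3 2 - g 0 2 1 3 + g 0 2 3 1 + g 0 3 1 2 - g 0 3 2 1 - g 1 0 2 3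
      + g 1 0 3 2 + g 1 2 0 3 - g 1 2 3 0 - g 1 3 0 2 + g 1 3 2 0 + g 2 0 1 3 - g 2 0 3 1
      - g 2 1 0 3 + g 2 1 3 0 + g 2 3 0 1 - g 2 3 1 0 - g 3 0 1 2 + g 3 0 2 1 + g 3 1 0 2
      - g 3 1 2 0 - g 3 2 0 1 + g 3 2 1 0 := by
  have h1 : (1 : Fin 5) = Fin.succ 0 := rfl
  have h2 : (2 : Fin 5) = Fin.succ (Fin.succ 0) := rfl
  have h3 : (3 : Fin 5) = Fin.succ (Fin.succ (Fin.succ 0)) := rfl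
  have h4 : (4 : Fin 5) = Fin.succ (Fin.succ (Fin.succ (Fin.succ 0))) := rfl
  simp only [h1, h2, h3, h4, sum_perm_succ, Fin.sum_univ_succ, Finset.univ_unique,
    Finset.sum_singleton, Equiv.Perm.decomposeFin.symm_sign,
    Equiv.Perm.decomposeFin_symm_apply_succ, Equiv.Perm.decomposeFin_symm_apply_zero]
  simp [Equiv.swap_apply_def, Fin.ext_iff]
  ring

theorem wedge_one_one (α β : Form 1) (p u v : E5) :
    (wedge α β : Form 2) p ![u, v] = α p ![u] * β p ![v] - α p ![v] * β p ![u] := by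
  refine (wedge_apply α β p ![u, v]).trans ?_
  have h := sum_perm_two fun i j =>
    α p ![(![u, v] : Fin 2 → E5) i] * β p ![(![u, v] : Fin 2 → E5) j]
  have e : ∀ σ : Equiv.Perm (Fin 2),
      α p (fun i => (![u, v] : Fin 2 → E5) (σ (Fin.castAdd 1 i))) *
        β p (fun i => (![u, v] : Fin 2 → E5) (σ (Fin.natAdd 1 i))) =
      α p ![(![u, v] : Fin 2 → E5) (σ 0)] * β p ![(![u, v] : Fin 2 → E5) (σ 1)] := by
    intro σ
    congr 2
    · exact vec_one _
    · exact vec_one _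
  refine (congrArg₂ (· * ·) rfl ((Finset.sum_congr rfl fun σ _ => by rw [e σ]).trans h)).trans ?_
  simp

theorem wedge_one_two (α : Form 1) (β : Form 2) (p u v w : E5) :
    (wedge α β : Form 3) p ![u, v, w] =
      α p ![u] * β p ![v, w] - α p ![v] * β p ![u, w] + α p ![w] * β p ![u, v] := by
  refine (wedge_apply α β p ![u, v, w]).trans ?_
  have h := sum_perm_three fun i j k =>
    α p ![(![u, v, w] : Fin 3 → E5) i] *
      β p ![(![u, v, w] : Fin 3 → E5) j, (![u, v, w] : Fin 3 → E5) k]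
  have e : ∀ σ : Equiv.Perm (Fin 3),
      α p (fun i => (![u, v, w] : Fin 3 → E5) (σ (Fin.castAdd 2 i))) *
        β p (fun i => (![u, v, w] : Fin 3 → E5) (σ (Fin.natAdd 1 i))) =
      α p ![(![u, v, w] : Fin 3 → E5) (σ 0)] *
        β p ![(![u, v, w] : Fin 3 → E5) (σ 1), (![u, v, w] : Fin 3 → E5) (σ 2)] := by
    intro σ
    congr 2
    · exact vec_one _
    · exact vec_two _
  refine (congrArg₂ (· * ·) rfl ((Finset.sum_congr rfl fun σ _ => by rw [e σ]).trans h)).trans ?_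
  simp only [Matrix.cons_val_zero, Matrix.cons_val_one, Matrix.cons_val]
  -- The six terms agree in pairs under a swap inside `β`, which absorbs the factor `1/(1! 2!)`.
  rw [form_two_swap (β p) w v, form_two_swap (β p) w u, form_two_swap (β p) v u]
  norm_num
  ring

theorem wedge_two_two (α β : Form 2) (p u v w x : E5) :
    (wedge α β : Form 4) p ![u, v, w, x] =
      α p ![u, v] * β p ![w, x] - α p ![u, w] * β p ![v, x] + α p ![u, x] * β p ![v, w]
      + α p ![v, w] * β p ![u, x] - α p ![v, x] * β p ![u, w] + α p ![w, x] * β p ![u, v] := by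
  refine (wedge_apply α β p ![u, v, w, x]).trans ?_
  have h := sum_perm_four fun i j k l =>
    α p ![(![u, v, w, x] : Fin 4 → E5) i, (![u, v, w, x] : Fin 4 → E5) j] *
      β p ![(![u, v, w, x] : Fin 4 → E5) k, (![u, v, w, x] : Fin 4 → E5) l]
  have e : ∀ σ : Equiv.Perm (Fin 4),
      α p (fun i => (![u, v, w, x] : Fin 4 → E5) (σ (Fin.castAdd 2 i))) *
        β p (fun i => (![u, v, w, x] : Fin 4 → E5) (σ (Fin.natAdd 2 i))) =
      α p ![(![u, v, w, x] : Fin 4 → E5) (σ 0), (![u, v, w, x] : Fin 4 → E5) (σ 1)] *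
        β p ![(![u, v, w, x] : Fin 4 → E5) (σ 2), (![u, v, w, x] : Fin 4 → E5) (σ 3)] := by
    intro σ
    congr 2
    · exact vec_two _
    · exact vec_two _
  refine (congrArg₂ (· * ·) rfl ((Finset.sum_congr rfl fun σ _ => by rw [e σ]).trans h)).trans ?_
  simp only [Matrix.cons_val_zero, Matrix.cons_val_one, Matrix.cons_val]
  rw [form_two_swap (α p) v u, form_two_swap (α p) w u, form_two_swap (α p) x u,
    form_two_swap (α p) w v, form_two_swap (α p) x v, form_two_swap (α p) x w,
    form_two_swap (β p) v u, form_two_swap (β p) w u, form_two_swap (β p) x u,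
    form_two_swap (β p) w v, form_two_swap (β p) x v, form_two_swap (β p) x w]
  norm_num
  ring

theorem wedge_smul_smul {k l : ℕ} (a b : ℝ) (α : Form k) (β : Form l) :
    wedge (a • α) (b • β) = (a * b) • wedge α β := by
  ext p v
  simp only [wedge_apply, Pi.smul_apply, ContinuousAlternatingMap.smul_apply, smul_eq_mul]
  simp only [Finset.mul_sum]
  exact Finset.sum_congr rfl fun σ _ => by ring

theorem form_ext_two {α β : Form 2} (h : ∀ p u v, α p ![u, v] = β p ![u, v]) : α = β := by
  ext p v; rw [vec_two v]; exact h _ _ _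

theorem form_ext_one {α β : Form 1} (h : ∀ p u, α p ![u] = β p ![u]) : α = β := by
  ext p v; rw [vec_one v]; exact h _ _

theorem form_ext_four {α β : Form 4} (h : ∀ p u v w x, α p ![u, v, w, x] = β p ![u, v, w, x]) :
    α = β := by
  ext p v; rw [vec_four v]; exact h _ _ _ _ _

/-! ### Exterior derivatives of 1-forms and of products with constant forms. -/

theorem extDeriv_one_apply {α : Form 1} (p : E5) (hα : DifferentiableAt ℝ α p) (u v : E5) :
    extDeriv α p ![u, v] =
      fderiv ℝ (fun q => α q ![v]) p u - fderiv ℝ (fun q => α q ![u]) p v := by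
  rw [extDeriv_apply hα]
  have h0 : (Fin.removeNth 0 ![u, v] : Fin 1 → E5) = ![v] := by ext i; fin_cases i; rfl
  have h1 : (Fin.removeNth 1 ![u, v] : Fin 1 → E5) = ![u] := by ext i; fin_cases i; rfl
  simp [Fin.sum_univ_succ, h0, h1]
  ring

theorem extDeriv_const {k : ℕ} (α : Form k) (hα : ∀ p q, α p = α q) : extDeriv α = 0 := by
  have h : α = fun _ => α 0 := funext fun p => hα p 0
  ext p v
  rw [h, extDeriv_apply (differentiableAt_const _)]
  simp

theorem dcoord_apply (i : Fin 5) (p u : E5) : dcoord i p ![u] = u i := by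
  simp [dcoord]

theorem form_one_smul (α : E5 [⋀^Fin 1]→L[ℝ] ℝ) (c : ℝ) (u : E5) : α ![c • u] = c * α ![u] := by
  have := α.toMultilinearMap.map_update_smul ![u] 0 c u
  have e : ∀ w : E5, Function.update ![u] 0 w = ![w] := fun w => by ext i; fin_cases i; rfl
  rw [e, e] at this
  exact this

theorem form_one_add (α : E5 [⋀^Fin 1]→L[ℝ] ℝ) (u v : E5) :
    α ![u + v] = α ![u] + α ![v] := by
  have := α.toMultilinearMap.map_update_add ![u] 0 u v
  have e : ∀ w : E5, Function.update ![u] 0 w = ![w] := fun w => by ext i; fin_cases i; rfl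
  rw [e, e, e] at this
  exact this

/-- A covector evaluated on one vector, as a linear map. -/
def covector (α : E5 [⋀^Fin 1]→L[ℝ] ℝ) : E5 →ₗ[ℝ] ℝ where
  toFun u := α ![u]
  map_add' := form_one_add α
  map_smul' c u := form_one_smul α c u

theorem form_one_expand (α : E5 [⋀^Fin 1]→L[ℝ] ℝ) (u : E5) :
    α ![u] = ∑ i, α ![Pi.single i 1] * u i := by
  have h := LinearMap.pi_apply_eq_sum_univ (covector α) u
  refine h.trans (Finset.sum_congr rfl fun i _ => ?_)
  have e : (fun j => if i = j then (1 : ℝ) else 0) = Pi.single i 1 := by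
    ext j
    simp [Pi.single_apply, eq_comm]
  rw [smul_eq_mul, mul_comm, e]
  rfl

/-- Expanding `α` in the coordinate basis writes `α ∧ β` as a finite sum of differentiable functions
times constant 3-forms. -/
theorem differentiable_wedge_const {α : Form 1} (hα : Differentiable ℝ α) {β : Form 2}
    (hβ : ∀ p q, β p = β q) : Differentiable ℝ (wedge α β : Form 3) := by
  have h : (wedge α β : Form 3) = fun p =>
      ∑ i, α p ![Pi.single i 1] • (wedge (dcoord i) β : Form 3) 0 := by
    ext p v
    rw [vec_three v]
    simp only [ContinuousAlternatingMap.sum_apply, ContinuousAlternatingMap.smul_apply,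
      wedge_one_two, dcoord_apply, hβ p 0, smul_eq_mul]
    rw [form_one_expand (α p) (v 0), form_one_expand (α p) (v 1), form_one_expand (α p) (v 2)]
    simp only [Finset.sum_mul]
    rw [← Finset.sum_sub_distrib, ← Finset.sum_add_distrib]
    exact Finset.sum_congr rfl fun i _ => by ring
  rw [h]
  refine Differentiable.fun_sum fun i _ => Differentiable.smul_const (fun p => ?_) _
  exact (hα p).continuousAlternatingMap_apply fun _ => differentiableAt_const _

/-- `d(α ∧ β) = dα ∧ β` for a 1-form `α` and a 2-form `β` with constant coefficients. -/
theorem extDeriv_wedge_const {α : Form 1} (hα : Differentiable ℝ α) {β : Form 2}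
    (hβ : ∀ p q, β p = β q) :
    extDeriv (wedge α β : Form 3) = wedge (extDeriv α : Form 2) β := by
  have hd : ∀ u, Differentiable ℝ fun q => α q ![u] := fun u p =>
    (hα p).continuousAlternatingMap_apply fun _ => differentiableAt_const _
  have hw : Differentiable ℝ (wedge α β : Form 3) := differentiable_wedge_const hα hβ
  refine form_ext_four fun p u v w x => ?_
  refine Eq.trans (extDeriv_apply (hw p) _) ?_
  have hf : ∀ a b c d : E5, fderiv ℝ (fun q => (wedge α β : Form 3) q ![a, b, c]) p d =
      fderiv ℝ (fun q => α q ![a]) p d * β p ![b, c] -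
      fderiv ℝ (fun q => α q ![b]) p d * β p ![a, c] +
      fderiv ℝ (fun q => α q ![c]) p d * β p ![a, b] := by
    intro a b c d
    have : (fun q => (wedge α β : Form 3) q ![a, b, c]) = fun q =>
        α q ![a] * β p ![b, c] - α q ![b] * β p ![a, c] + α q ![c] * β p ![a, b] := by
      funext q
      rw [wedge_one_two, hβ q p]
    rw [this]
    have H := ((((hd a p).hasFDerivAt.mul_const (β p ![b, c])).sub
      ((hd b p).hasFDerivAt.mul_const (β p ![a, c]))).add
      ((hd c p).hasFDerivAt.mul_const (β p ![a, b]))).fderiv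
    refine (congrArg (fun L => L d) H).trans ?_
    simp
    ring
  have h0 : (Fin.removeNth 0 ![u, v, w, x] : Fin 3 → E5) = ![v, w, x] := by
    ext i; fin_cases i <;> rfl
  have h1 : (Fin.removeNth 1 ![u, v, w, x] : Fin 3 → E5) = ![u, w, x] := by
    ext i; fin_cases i <;> rfl
  have h2 : (Fin.removeNth 2 ![u, v, w, x] : Fin 3 → E5) = ![u, v, x] := by
    ext i; fin_cases i <;> rfl
  have h3 : (Fin.removeNth 3 ![u, v, w, x] : Fin 3 → E5) = ![u, v, w] := by
    ext i; fin_cases i <;> rfl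
  rw [wedge_two_two, Fin.sum_univ_four, h0, h1, h2, h3, hf, hf, hf, hf]
  simp only [extDeriv_one_apply p (hα p)]
  simp
  ring

/-! ### Connections, curvature and Pontrjagin forms of a contact coframe. -/

/-- The components of `dη = a (e¹² - e³⁴) + b (e¹³ + e²⁴) + c (e¹⁴ - e²³)`. -/
def asdMatrix (a b c : ℝ) : Fin 5 → Fin 5 → ℝ :=
  ![![0, a, b, c, 0],
    ![-a, 0, -c, b, 0],
    ![-b, c, 0, -a, 0],
    ![-c, -b, a, 0, 0],
    ![0, 0, 0, 0, 0]]

theorem asdMatrix_swap (a b c : ℝ) (i j : Fin 5) : asdMatrix a b c i j = -asdMatrix a b c j i := by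
  fin_cases i <;> fin_cases j <;> simp [asdMatrix]

theorem asdMatrix_four_left (a b c : ℝ) (j : Fin 5) : asdMatrix a b c 4 j = 0 := by
  fin_cases j <;> simp [asdMatrix]

theorem asdMatrix_four_right (a b c : ℝ) (j : Fin 5) : asdMatrix a b c j 4 = 0 := by
  fin_cases j <;> simp [asdMatrix]

/-- An orthonormal coframe with closed constant `e¹, …, e⁴` and
`de⁵ = a (e¹² - e³⁴) + b (e¹³ + e²⁴) + c (e¹⁴ - e²³)`. -/
structure IsContactCoframe (θ : Fin 5 → Form 1) (a b c : ℝ) : Prop where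
  dual : ∀ i j p, θ i p ![frame θ j p] = if i = j then 1 else 0
  differentiable_frame : ∀ i, Differentiable ℝ (frame θ i)
  differentiable : ∀ i, Differentiable ℝ (θ i)
  const : ∀ i, i ≠ 4 → ∀ p q, θ i p = θ i q
  structureEq : extDeriv (θ 4) = a • (e2 θ 0 1 - e2 θ 2 3) + b • (e2 θ 0 2 + e2 θ 1 3)
    + c • (e2 θ 0 3 - e2 θ 1 2)

theorem e2_apply (θ : Fin 5 → Form 1) (i j : Fin 5) (p u v : E5) :
    e2 θ i j p ![u, v] = θ i p ![u] * θ j p ![v] - θ i p ![v] * θ j p ![u] :=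
  wedge_one_one _ _ _ _ _

namespace IsContactCoframe

variable {θ : Fin 5 → Form 1} {a b c : ℝ}

theorem extDeriv_of_ne (h : IsContactCoframe θ a b c) {i : Fin 5} (hi : i ≠ 4) :
    extDeriv (θ i) = 0 :=
  extDeriv_const _ (h.const i hi)

theorem deta_apply (h : IsContactCoframe θ a b c) (p u v : E5) :
    extDeriv (θ 4) p ![u, v] =
      ∑ i, ∑ j, asdMatrix a b c i j * (θ i p ![u] * θ j p ![v]) := by
  rw [h.structureEq]
  change a * (e2 θ 0 1 p ![u, v] - e2 θ 2 3 p ![u, v]) +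
    b * (e2 θ 0 2 p ![u, v] + e2 θ 1 3 p ![u, v]) +
    c * (e2 θ 0 3 p ![u, v] - e2 θ 1 2 p ![u, v]) = _
  simp only [e2_apply, Fin.sum_univ_five]
  simp [asdMatrix]
  ring

theorem extDeriv_apply (h : IsContactCoframe θ a b c) (i : Fin 5) (p u v : E5) :
    extDeriv (θ i) p ![u, v] =
      if i = 4 then ∑ i, ∑ j, asdMatrix a b c i j * (θ i p ![u] * θ j p ![v]) else 0 := by
  split_ifs with hi
  · rw [hi, h.deta_apply]
  · rw [h.extDeriv_of_ne hi]; rfl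

theorem deta_frame (h : IsContactCoframe θ a b c) (p : E5) (i j : Fin 5) :
    extDeriv (θ 4) p ![frame θ i p, frame θ j p] = asdMatrix a b c i j := by
  rw [h.deta_apply]
  simp [h.dual]

theorem deta_frame_right (h : IsContactCoframe θ a b c) (p u : E5) (j : Fin 5) :
    extDeriv (θ 4) p ![u, frame θ j p] = ∑ i, asdMatrix a b c i j * θ i p ![u] := by
  rw [h.deta_apply]
  simp [h.dual]

/-- `dη` has no component along `η`, and the remaining coframe elements do not vary in the
coordinates. -/
theorem deta_const (h : IsContactCoframe θ a b c) (p q : E5) :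
    (extDeriv (θ 4) : Form 2) p = extDeriv (θ 4) q := by
  ext v
  rw [vec_two v, h.deta_apply, h.deta_apply]
  refine Finset.sum_congr rfl fun i _ => Finset.sum_congr rfl fun j _ => ?_
  by_cases hi : i = 4
  · simp [hi, asdMatrix_four_left]
  by_cases hj : j = 4
  · simp [hj, asdMatrix_four_right]
  rw [h.const i hi p q, h.const j hj p q]

/-- Cartan's formula: the pairings of coframe and frame are constant, so its derivative terms vanish
and `dθⁱ(E_j, E_k) = -θⁱ([E_j, E_k])`. -/
theorem bracket (h : IsContactCoframe θ a b c) (i j k : Fin 5) (p : E5) :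
    θ i p ![VectorField.lieBracket ℝ (frame θ j) (frame θ k) p] =
      if i = 4 then -asdMatrix a b c j k else 0 := by
  have H := extDeriv_apply_vectorField (V := ![frame θ j, frame θ k]) (h.differentiable i p)
    (by intro l; fin_cases l
        · exact h.differentiable_frame j p
        · exact h.differentiable_frame k p)
  have hv : (fun l => (![frame θ j, frame θ k] : Fin 2 → E5 → E5) l p) =
      ![frame θ j p, frame θ k p] := vec_two _
  have h0 : ∀ x, θ i x ((0 : Fin 2).removeNth fun l => (![frame θ j, frame θ k] : Fin 2 → E5 → E5)
      l x) = if i = k then 1 else 0 := fun x => by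
    rw [← h.dual i k x]
    congr 1
    exact vec_one _
  have h1 : ∀ x, θ i x ((1 : Fin 2).removeNth fun l => (![frame θ j, frame θ k] : Fin 2 → E5 → E5)
      l x) = if i = j then 1 else 0 := fun x => by
    rw [← h.dual i j x]
    congr 1
    exact vec_one _
  rw [hv, h.extDeriv_apply] at H
  have s1 := Fin.sum_univ_two fun l : Fin 2 => (-1 : ℤ) ^ l.val • fderiv ℝ (fun x => θ i x
    (l.removeNth fun l => (![frame θ j, frame θ k] : Fin 2 → E5 → E5) l x)) p
      ((![frame θ j, frame θ k] : Fin 2 → E5 → E5) l p)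
  simp only [h0, h1] at s1
  rw [show (∑ l : Fin 2, (-1 : ℤ) ^ l.val • fderiv ℝ (fun x => θ i x
    (l.removeNth fun l => (![frame θ j, frame θ k] : Fin 2 → E5 → E5) l x)) p
      ((![frame θ j, frame θ k] : Fin 2 → E5 → E5) l p)) = 0 by rw [s1]; simp] at H
  simp [h.dual] at H
  split_ifs at H ⊢ <;> linarith

theorem comp_torsion (h : IsContactCoframe θ a b c) (i j k : Fin 5) (p : E5) :
    comp θ (torsionForm θ) ![i, j, k] p =
      (if 4 = i then asdMatrix a b c j k else 0) - (if 4 = j then asdMatrix a b c i k else 0)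
        + (if 4 = k then asdMatrix a b c i j else 0) := by
  have : (fun l => frame θ ((![i, j, k] : Fin 3 → Fin 5) l) p) =
      ![frame θ i p, frame θ j p, frame θ k p] := vec_three _
  rw [comp, this, torsionForm, wedge_one_two]
  simp [h.dual, h.deta_frame]

/-- The Christoffel symbols `wⁱⱼ(E_k)` of the Levi-Civita connection. -/
def lcSymbol (a b c : ℝ) (i j k : Fin 5) : ℝ :=
  1 / 2 * ((if 4 = k then asdMatrix a b c j i else 0) - (if 4 = i then asdMatrix a b c k j else 0)
    - (if 4 = j then asdMatrix a b c i k else 0))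

theorem leviCivita_eq (h : IsContactCoframe θ a b c) (i j : Fin 5) :
    leviCivita θ i j = ∑ k, lcSymbol a b c i j k • θ k := by
  refine form_ext_one fun p u => ?_
  simp only [leviCivita, h.bracket, Finset.sum_apply, Pi.smul_apply,
    ContinuousAlternatingMap.sum_apply, ContinuousAlternatingMap.smul_apply, smul_eq_mul, lcSymbol]
  refine Finset.sum_congr rfl fun k _ => ?_
  congr 2
  simp only [eq_comm (a := (4 : Fin 5))]
  split_ifs <;> ring

/-- By skewness of `asdMatrix`, half of the torsion doubles the Levi-Civita term along `η` and
cancels the terms along `e¹, …, e⁴`. -/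
theorem plusConn_eq (h : IsContactCoframe θ a b c) :
    plusConn θ (torsionForm θ) = fun i j => asdMatrix a b c j i • θ 4 := by
  funext i j
  refine form_ext_one fun p u => ?_
  rw [plusConn, h.leviCivita_eq]
  simp only [h.comp_torsion, Finset.sum_apply, Pi.smul_apply, ContinuousAlternatingMap.add_apply,
    ContinuousAlternatingMap.sum_apply, ContinuousAlternatingMap.smul_apply, smul_eq_mul, lcSymbol]
  rw [← Finset.sum_add_distrib]
  rw [Finset.sum_eq_single_of_mem 4 (Finset.mem_univ _)]
  · simp [asdMatrix_four_left, asdMatrix_four_right]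
    ring
  · intro k _ hk
    rw [asdMatrix_swap a b c i k]
    simp only [Ne.symm hk, if_false]
    split_ifs <;> ring

theorem instantonConn_eq (l m t : ℝ) :
    instantonConn θ l m t = fun i j => asdMatrix l m t j i • θ 4 := by
  funext i j
  rw [instantonConn]
  congr 1
  fin_cases i <;> fin_cases j <;> simp [asdMatrix]

/-- Through this identification every curvature computation for `∇⁺` is the one for `A`, with other
parameters. -/
theorem plusConn_eq_instantonConn (h : IsContactCoframe θ a b c) :
    plusConn θ (torsionForm θ) = instantonConn θ a b c := by
  rw [h.plusConn_eq, instantonConn_eq]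

theorem wedge_sum_smul_apply (G G' : Fin 5 → ℝ) (p u v : E5) :
    (wedge (∑ k, G k • θ k) (∑ k, G' k • θ k) : Form 2) p ![u, v] =
      (∑ k, G k * θ k p ![u]) * (∑ k, G' k * θ k p ![v]) -
      (∑ k, G k * θ k p ![v]) * (∑ k, G' k * θ k p ![u]) := by
  rw [wedge_one_one]
  simp only [Finset.sum_apply, Pi.smul_apply, ContinuousAlternatingMap.sum_apply,
    ContinuousAlternatingMap.smul_apply, smul_eq_mul]

theorem extDeriv_sum_smul (h : IsContactCoframe θ a b c) (G : Fin 5 → ℝ) :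
    extDeriv (∑ k, G k • θ k) = G 4 • extDeriv (θ 4) := by
  have hs : ∀ k, extDeriv (G k • θ k) = G k • extDeriv (θ k) := fun k =>
    funext fun p => extDeriv_smul _ _
  have hd : ∀ k p, DifferentiableAt ℝ (G k • θ k) p := fun k p =>
    (h.differentiable k p).const_smul _
  have h4 : ∀ k, k ≠ 4 → extDeriv (G k • θ k) = 0 := fun k hk => by
    rw [hs, h.extDeriv_of_ne hk, smul_zero]
  funext p
  rw [Fin.sum_univ_five]
  rw [_root_.extDeriv_add ((((hd 0 p).add (hd 1 p)).add (hd 2 p)).add (hd 3 p)) (hd 4 p),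
    _root_.extDeriv_add (((hd 0 p).add (hd 1 p)).add (hd 2 p)) (hd 3 p),
    _root_.extDeriv_add ((hd 0 p).add (hd 1 p)) (hd 2 p),
    _root_.extDeriv_add (hd 0 p) (hd 1 p), h4 0 (by decide), h4 1 (by decide), h4 2 (by decide),
    h4 3 (by decide), hs]
  simp

/-- All connection forms are multiples of the single 1-form `θ 4`, so their wedge products vanish
and only the exterior derivative remains. -/
theorem curvature_instantonConn (l m t : ℝ) (i j : Fin 5) :
    curvature (instantonConn θ l m t) i j = asdMatrix l m t j i • extDeriv (θ 4) := by
  rw [instantonConn_eq, curvature]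
  have h0 : ∀ k, (wedge (asdMatrix l m t k i • θ 4) (asdMatrix l m t j k • θ 4) : Form 2) = 0 := by
    intro k
    refine form_ext_two fun p u v => ?_
    rw [wedge_one_one]
    simp
    ring
  rw [Finset.sum_eq_zero fun k _ => h0 k, add_zero]
  exact funext fun p => extDeriv_smul _ _

theorem curvature_leviCivita (h : IsContactCoframe θ a b c) (i j : Fin 5) (p u v : E5) :
    curvature (leviCivita θ) i j p ![u, v] =
      lcSymbol a b c i j 4 * extDeriv (θ 4) p ![u, v] +
      ∑ k, ((∑ x, lcSymbol a b c i k x * θ x p ![u]) * (∑ x, lcSymbol a b c k j x * θ x p ![v]) -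
        (∑ x, lcSymbol a b c i k x * θ x p ![v]) * (∑ x, lcSymbol a b c k j x * θ x p ![u])) := by
  simp only [curvature, h.leviCivita_eq, h.extDeriv_sum_smul]
  simp only [Pi.add_apply, ContinuousAlternatingMap.add_apply, Finset.sum_apply, Pi.smul_apply,
    ContinuousAlternatingMap.sum_apply, ContinuousAlternatingMap.smul_apply, smul_eq_mul]
  congr 1
  exact Finset.sum_congr rfl fun k _ => wedge_sum_smul_apply _ _ _ _ _

/-- Each parameter occurs twice above the diagonal, so the squares add up to `2 (l² + m² + t²)`. -/
theorem pontrjagin_instantonConn (l m t : ℝ) :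
    pontrjagin (instantonConn θ l m t) =
      ((l ^ 2 + m ^ 2 + t ^ 2) / (4 * Real.pi ^ 2)) •
        (wedge (extDeriv (θ 4)) (extDeriv (θ 4)) : Form 4) := by
  rw [pontrjagin]
  simp only [curvature_instantonConn, wedge_smul_smul, ← Finset.sum_smul, smul_smul]
  congr 1
  have : ∀ i : Fin 5, ∑ j ∈ Finset.Ioi i, asdMatrix l m t j i * asdMatrix l m t j i =
      ∑ j, if i < j then asdMatrix l m t j i * asdMatrix l m t j i else 0 := by
    intro i
    rw [← Finset.sum_filter]
    congr 1
    ext j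
    simp
  simp only [this, Fin.sum_univ_five]
  simp [asdMatrix]
  field_simp
  ring

theorem extDeriv_torsionForm (h : IsContactCoframe θ a b c) :
    extDeriv (torsionForm θ) = (wedge (extDeriv (θ 4)) (extDeriv (θ 4)) : Form 4) :=
  extDeriv_wedge_const (h.differentiable 4) h.deta_const

theorem extDeriv_torsionForm_eq (h : IsContactCoframe θ a b c) {l m t : ℝ}
    (hlt : l ^ 2 + m ^ 2 + t ^ 2 < a ^ 2 + b ^ 2 + c ^ 2) :
    extDeriv (torsionForm θ) =
      (2 * Real.pi ^ 2 * (2 / (a ^ 2 + b ^ 2 + c ^ 2 - l ^ 2 - m ^ 2 - t ^ 2))) •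
        (pontrjagin (plusConn θ (torsionForm θ)) - pontrjagin (instantonConn θ l m t)) := by
  rw [h.extDeriv_torsionForm, h.plusConn_eq_instantonConn, pontrjagin_instantonConn,
    pontrjagin_instantonConn]
  generalize (wedge (extDeriv (θ 4)) (extDeriv (θ 4)) : Form 4) = W
  have : a ^ 2 + b ^ 2 + c ^ 2 - l ^ 2 - m ^ 2 - t ^ 2 ≠ 0 := by linarith
  have hpi := Real.pi_ne_zero
  refine form_ext_four fun p u v w x => ?_
  simp only [Pi.smul_apply, Pi.sub_apply, ContinuousAlternatingMap.sub_apply,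
    ContinuousAlternatingMap.smul_apply, smul_eq_mul]
  -- The two Pontrjagin forms differ by `(r - s)/(4π²)` times `W`, with `r - s` the denominator of
  -- `α'`; the scalars multiply to `1`.
  field_simp
  ring

end IsContactCoframe

/-! ### Torsion, parallel forms, the `SU(2)`-structure and the instanton condition. -/

theorem comp_one (θ : Fin 5 → Form 1) (α : Form 1) (i : Fin 5) (p : E5) :
    comp θ α ![i] p = α p ![frame θ i p] := by
  rw [comp]
  congr 1
  exact vec_one _

theorem comp_two (θ : Fin 5 → Form 1) (α : Form 2) (i j : Fin 5) (p : E5) :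
    comp θ α ![i, j] p = α p ![frame θ i p, frame θ j p] := by
  rw [comp]
  congr 1
  exact vec_two _

theorem frameDeriv_const (θ : Fin 5 → Form 1) (m : Fin 5) (x : ℝ) (p : E5) :
    frameDeriv θ m (fun _ => x) p = 0 := by
  simp [frameDeriv]

theorem covDeriv_one (θ : Fin 5 → Form 1) (w : Conn (Fin 5)) (P : (Fin 1 → Fin 5) → E5 → ℝ)
    (m i : Fin 5) (p : E5) : covDeriv θ w P m ![i] p = frameDeriv θ m (P ![i]) p -
      ∑ s, w s i p ![frame θ m p] * P ![s] p := by
  have h0 : ∀ s, Function.update ![i] 0 s = ![s] := fun s => by ext k; fin_cases k; rfl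
  simp [covDeriv, h0]

theorem covDeriv_two (θ : Fin 5 → Form 1) (w : Conn (Fin 5)) (P : (Fin 2 → Fin 5) → E5 → ℝ)
    (m i j : Fin 5) (p : E5) : covDeriv θ w P m ![i, j] p = frameDeriv θ m (P ![i, j]) p -
      (∑ s, w s i p ![frame θ m p] * P ![s, j] p + ∑ s, w s j p ![frame θ m p] * P ![i, s] p) := by
  have h0 : ∀ s, Function.update ![i, j] 0 s = ![s, j] := fun s => by ext k; fin_cases k <;> rfl
  have h1 : ∀ s, Function.update ![i, j] 1 s = ![i, s] := fun s => by ext k; fin_cases k <;> rfl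
  simp [covDeriv, Fin.sum_univ_two, h0, h1]

theorem covDeriv_three (θ : Fin 5 → Form 1) (w : Conn (Fin 5)) (P : (Fin 3 → Fin 5) → E5 → ℝ)
    (m i j k : Fin 5) (p : E5) : covDeriv θ w P m ![i, j, k] p = frameDeriv θ m (P ![i, j, k]) p -
      (∑ s, w s i p ![frame θ m p] * P ![s, j, k] p + ∑ s, w s j p ![frame θ m p] * P ![i, s, k] p
        + ∑ s, w s k p ![frame θ m p] * P ![i, j, s] p) := by
  have h0 : ∀ s, Function.update ![i, j, k] 0 s = ![s, j, k] := fun s => by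
    ext k; fin_cases k <;> rfl
  have h1 : ∀ s, Function.update ![i, j, k] 1 s = ![i, s, k] := fun s => by
    ext k; fin_cases k <;> rfl
  have h2 : ∀ s, Function.update ![i, j, k] 2 s = ![i, j, s] := fun s => by
    ext k; fin_cases k <;> rfl
  simp [covDeriv, Fin.sum_univ_three, h0, h1, h2]

theorem isMetricWithTorsion_iff (θ : Fin 5 → Form 1) (w : Conn (Fin 5)) (T : Form 3) :
    IsMetricWithTorsion θ w T ↔ (∀ i j p u, w i j p ![u] = -w j i p ![u]) ∧
      ∀ i p u v, extDeriv (θ i) p ![u, v] +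
        ∑ j, (w i j p ![u] * θ j p ![v] - w i j p ![v] * θ j p ![u]) =
        T p ![u, v, frame θ i p] := by
  refine and_congr ⟨fun h i j p u => ?_, fun h i j => form_ext_one (h i j)⟩
    (forall₄_congr fun i p u v => ?_)
  · rw [h i j]; rfl
  · have e : (extDeriv (θ i) + ∑ j, wedge (w i j) (θ j) : Form 2) p ![u, v] =
        extDeriv (θ i) p ![u, v] +
          ∑ j, (w i j p ![u] * θ j p ![v] - w i j p ![v] * θ j p ![u]) := by
      simp only [← wedge_one_one]
      simp only [Pi.add_apply, ContinuousAlternatingMap.add_apply, Finset.sum_apply,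
        ContinuousAlternatingMap.sum_apply]
    rw [← e]

/-- The product is evaluated on `e`; as `β` is dual to `e 4`, only permutations fixing the last slot
contribute. -/
theorem wedge_four_one_ne_zero (α : Form 4) (β : Form 1) (p : E5) (e : Fin 5 → E5)
    (hβ : ∀ i, β p ![e i] = if i = 4 then 1 else 0) (g : Fin 5 → Fin 5 → Fin 5 → Fin 5 → ℝ)
    (hg : ∀ i j k l, α p ![e i, e j, e k, e l] = g i j k l)
    (hne : g 0 1 2 3 - g 0 1 3 2 - g 0 2 1 3 + g 0 2 3 1 + g 0 3 1 2 - g 0 3 2 1 - g 1 0 2 3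
      + g 1 0 3 2 + g 1 2 0 3 - g 1 2 3 0 - g 1 3 0 2 + g 1 3 2 0 + g 2 0 1 3 - g 2 0 3 1
      - g 2 1 0 3 + g 2 1 3 0 + g 2 3 0 1 - g 2 3 1 0 - g 3 0 1 2 + g 3 0 2 1 + g 3 1 0 2
      - g 3 1 2 0 - g 3 2 0 1 + g 3 2 1 0 ≠ 0) :
    wedge α β p ≠ 0 := by
  intro h0
  have hw := (congrArg (fun f => f e) h0).symm.trans (wedge_apply α β p e)
  rw [← sum_perm_five] at hne
  have hfac : (((Nat.factorial 4 * Nat.factorial 1 : ℕ) : ℝ)⁻¹) ≠ 0 := by positivity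
  refine hne (Eq.trans (Finset.sum_congr rfl fun σ _ => ?_)
    ((mul_eq_zero.1 hw.symm).resolve_left hfac))
  have h1 : α p (fun i => e (σ (Fin.castAdd 1 i))) = α p ![e (σ 0), e (σ 1), e (σ 2), e (σ 3)] :=
    congrArg (α p) (vec_four _)
  have h2 : β p (fun i => e (σ (Fin.natAdd 4 i))) = if σ 4 = 4 then 1 else 0 :=
    (congrArg (β p) (vec_one _)).trans (hβ _)
  rw [h1, h2, hg]

/-- The components of the self-dual forms `F₁, F₂, F₃`. -/
def su2Matrix : Fin 3 → Fin 5 → Fin 5 → ℝ :=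
  ![![![0, 1, 0, 0, 0], ![-1, 0, 0, 0, 0], ![0, 0, 0, 1, 0], ![0, 0, -1, 0, 0], ![0, 0, 0, 0, 0]],
    ![![0, 0, 1, 0, 0], ![0, 0, 0, -1, 0], ![-1, 0, 0, 0, 0], ![0, 1, 0, 0, 0], ![0, 0, 0, 0, 0]],
    ![![0, 0, 0, 1, 0], ![0, 0, 1, 0, 0], ![0, -1, 0, 0, 0], ![-1, 0, 0, 0, 0], ![0, 0, 0, 0, 0]]]

theorem su2Forms_apply (θ : Fin 5 → Form 1) (r : Fin 3) (p u v : E5) :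
    su2Forms θ r p ![u, v] = ∑ i, ∑ j, su2Matrix r i j * (θ i p ![u] * θ j p ![v]) := by
  have h0 : su2Forms θ 0 p ![u, v] = e2 θ 0 1 p ![u, v] + e2 θ 2 3 p ![u, v] := rfl
  have h1 : su2Forms θ 1 p ![u, v] = e2 θ 0 2 p ![u, v] + e2 θ 3 1 p ![u, v] := rfl
  have h2 : su2Forms θ 2 p ![u, v] = e2 θ 0 3 p ![u, v] + e2 θ 1 2 p ![u, v] := rfl
  fin_cases r
  · refine h0.trans ?_
    simp only [e2_apply, Fin.sum_univ_five]
    simp [su2Matrix]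
    ring
  · refine h1.trans ?_
    simp only [e2_apply, Fin.sum_univ_five]
    simp [su2Matrix]
    ring
  · refine h2.trans ?_
    simp only [e2_apply, Fin.sum_univ_five]
    simp [su2Matrix]
    ring

theorem su2Matrix_four_left (r : Fin 3) (j : Fin 5) : su2Matrix r 4 j = 0 := by
  fin_cases r <;> fin_cases j <;> simp [su2Matrix]

theorem su2Matrix_four_right (r : Fin 3) (j : Fin 5) : su2Matrix r j 4 = 0 := by
  fin_cases r <;> fin_cases j <;> simp [su2Matrix]

theorem wedge_su2Forms_self (θ : Fin 5 → Form 1) (r : Fin 3) :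
    (wedge (su2Forms θ r) (su2Forms θ r) : Form 4) = wedge (su2Forms θ 0) (su2Forms θ 0) := by
  refine form_ext_four fun p u v w x => ?_
  simp only [wedge_two_two, su2Forms_apply]
  fin_cases r <;> simp [su2Matrix, Fin.sum_univ_five] <;> ring

theorem wedge_su2Forms_zero_one (θ : Fin 5 → Form 1) :
    (wedge (su2Forms θ 0) (su2Forms θ 1) : Form 4) = 0 := by
  refine form_ext_four fun p u v w x => ?_
  simp only [wedge_two_two, su2Forms_apply]
  simp [su2Matrix, Fin.sum_univ_five]
  ring

theorem wedge_su2Forms_zero_two (θ : Fin 5 → Form 1) :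
    (wedge (su2Forms θ 0) (su2Forms θ 2) : Form 4) = 0 := by
  refine form_ext_four fun p u v w x => ?_
  simp only [wedge_two_two, su2Forms_apply]
  simp [su2Matrix, Fin.sum_univ_five]
  ring

theorem wedge_su2Forms_one_two (θ : Fin 5 → Form 1) :
    (wedge (su2Forms θ 1) (su2Forms θ 2) : Form 4) = 0 := by
  refine form_ext_four fun p u v w x => ?_
  simp only [wedge_two_two, su2Forms_apply]
  simp [su2Matrix, Fin.sum_univ_five]
  ring

theorem wedge_two_comm (α β : Form 2) : (wedge α β : Form 4) = wedge β α := by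
  refine form_ext_four fun p u v w x => ?_
  rw [wedge_two_two, wedge_two_two]
  ring

theorem wedge_su2Forms (θ : Fin 5 → Form 1) (r s : Fin 3) :
    (wedge (su2Forms θ r) (su2Forms θ s) : Form 4) =
      if r = s then wedge (su2Forms θ 0) (su2Forms θ 0) else 0 := by
  split_ifs with hrs
  · subst hrs
    exact wedge_su2Forms_self θ r
  · fin_cases r <;> fin_cases s
    · exact absurd rfl hrs
    · exact wedge_su2Forms_zero_one θ
    · exact wedge_su2Forms_zero_two θ
    · exact (wedge_two_comm _ _).trans (wedge_su2Forms_zero_one θ)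
    · exact absurd rfl hrs
    · exact wedge_su2Forms_one_two θ
    · exact (wedge_two_comm _ _).trans (wedge_su2Forms_zero_two θ)
    · exact (wedge_two_comm _ _).trans (wedge_su2Forms_one_two θ)
    · exact absurd rfl hrs

/-- Anti-self-dual forms commute with self-dual ones. -/
theorem asdMatrix_su2Matrix (a b c : ℝ) (r : Fin 3) (i j : Fin 5) :
    ∑ s, asdMatrix a b c i s * su2Matrix r s j + ∑ s, asdMatrix a b c j s * su2Matrix r i s = 0 := by
  fin_cases r <;> fin_cases i <;> fin_cases j <;>
    simp [asdMatrix, su2Matrix, Fin.sum_univ_five]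

namespace IsContactCoframe

variable {θ : Fin 5 → Form 1} {a b c : ℝ}

theorem su2Forms_frame (h : IsContactCoframe θ a b c) (r : Fin 3) (p : E5) (i j : Fin 5) :
    su2Forms θ r p ![frame θ i p, frame θ j p] = su2Matrix r i j := by
  rw [su2Forms_apply]
  simp [h.dual]

theorem extDeriv_su2Forms (h : IsContactCoframe θ a b c) (r : Fin 3) :
    extDeriv (su2Forms θ r) = 0 := by
  refine extDeriv_const _ fun p q => ?_
  ext v
  rw [vec_two v, su2Forms_apply, su2Forms_apply]
  refine Finset.sum_congr rfl fun i _ => Finset.sum_congr rfl fun j _ => ?_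
  by_cases hi : i = 4
  · simp [hi, su2Matrix_four_left]
  by_cases hj : j = 4
  · simp [hj, su2Matrix_four_right]
  rw [h.const i hi p q, h.const j hj p q]

theorem isHorizontalASD (h : IsContactCoframe θ a b c) : IsHorizontalASD θ (extDeriv (θ 4)) := by
  intro p
  simp only [comp_two, h.deta_frame]
  refine ⟨fun j => asdMatrix_four_left a b c j, ?_, ?_, ?_⟩ <;> simp [asdMatrix]

theorem plusConn_apply (h : IsContactCoframe θ a b c) (i j : Fin 5) (p u : E5) :
    plusConn θ (torsionForm θ) i j p ![u] = asdMatrix a b c j i * θ 4 p ![u] := by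
  rw [h.plusConn_eq]
  rfl

theorem leviCivita_apply (h : IsContactCoframe θ a b c) (i j : Fin 5) (p u : E5) :
    leviCivita θ i j p ![u] = ∑ k, lcSymbol a b c i j k * θ k p ![u] := by
  rw [h.leviCivita_eq]
  simp only [Finset.sum_apply, Pi.smul_apply, ContinuousAlternatingMap.sum_apply,
    ContinuousAlternatingMap.smul_apply, smul_eq_mul]

theorem leviCivita_frame (h : IsContactCoframe θ a b c) (i j k : Fin 5) (p : E5) :
    leviCivita θ i j p ![frame θ k p] = lcSymbol a b c i j k := by
  rw [h.leviCivita_apply]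
  simp [h.dual]

theorem plusConn_frame (h : IsContactCoframe θ a b c) (i j k : Fin 5) (p : E5) :
    plusConn θ (torsionForm θ) i j p ![frame θ k p] =
      if 4 = k then asdMatrix a b c j i else 0 := by
  rw [h.plusConn_apply, h.dual]
  simp

theorem isMetricWithTorsion_plusConn (h : IsContactCoframe θ a b c) :
    IsMetricWithTorsion θ (plusConn θ (torsionForm θ)) (torsionForm θ) := by
  refine (isMetricWithTorsion_iff _ _ _).2 ⟨fun i j p u => ?_, fun i p u v => ?_⟩
  · rw [h.plusConn_apply, h.plusConn_apply, asdMatrix_swap a b c j i, neg_mul]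
  · simp only [h.plusConn_apply]
    rw [torsionForm, wedge_one_two, h.deta_frame_right, h.deta_frame_right, h.dual,
      Finset.sum_sub_distrib, Finset.mul_sum, Finset.mul_sum]
    have e : extDeriv (θ i) p ![u, v] = (if 4 = i then 1 else 0) * extDeriv (θ 4) p ![u, v] := by
      by_cases hi : 4 = i
      · subst hi; simp
      · rw [h.extDeriv_of_ne (Ne.symm hi)]; simp [hi]
    rw [e, add_comm]
    congr 2 <;> exact Finset.sum_congr rfl fun j _ => by ring

theorem isMetricWithTorsion_leviCivita (h : IsContactCoframe θ a b c) :
    IsMetricWithTorsion θ (leviCivita θ) 0 := by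
  refine (isMetricWithTorsion_iff _ _ _).2 ⟨fun i j p u => ?_, fun i p u v => ?_⟩
  · rw [h.leviCivita_apply, h.leviCivita_apply, ← Finset.sum_neg_distrib]
    refine Finset.sum_congr rfl fun k _ => ?_
    rw [lcSymbol, lcSymbol, asdMatrix_swap a b c i j, asdMatrix_swap a b c k j,
      asdMatrix_swap a b c k i]
    split_ifs <;> ring
  · simp only [h.leviCivita_apply, h.extDeriv_apply]
    fin_cases i <;> simp [Fin.sum_univ_five, lcSymbol, asdMatrix] <;> ring

theorem isParallel_eta (h : IsContactCoframe θ a b c) :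
    IsParallel θ (plusConn θ (torsionForm θ)) (θ 4) := by
  intro m I p
  rw [vec_one I, covDeriv_one]
  have e : comp θ (θ 4) ![I 0] = fun _ => if 4 = I 0 then 1 else 0 := by
    funext q
    rw [comp_one, h.dual]
  rw [e, frameDeriv_const]
  simp [comp_one, h.dual, h.plusConn_frame, asdMatrix_four_right]

/-- `∇⁺` acts on constant tensors through `η` times a matrix in the anti-self-dual half of `so(4)`,
which annihilates self-dual forms. -/
theorem isParallel_su2Forms (h : IsContactCoframe θ a b c) (r : Fin 3) :
    IsParallel θ (plusConn θ (torsionForm θ)) (su2Forms θ r) := by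
  intro m I p
  rw [vec_two I, covDeriv_two]
  have e : comp θ (su2Forms θ r) ![I 0, I 1] = fun _ => su2Matrix r (I 0) (I 1) := by
    funext q
    rw [comp_two, h.su2Forms_frame]
  rw [e, frameDeriv_const]
  simp only [comp_two, h.su2Forms_frame, h.plusConn_frame]
  split_ifs
  · rw [asdMatrix_su2Matrix, sub_zero]
  · simp

theorem instantonConn_skew (l m t : ℝ) (i j : Fin 5) :
    instantonConn θ l m t i j = -instantonConn θ l m t j i := by
  refine form_ext_one fun p u => ?_
  rw [instantonConn_eq]
  change asdMatrix l m t j i * θ 4 p ![u] = -(asdMatrix l m t i j * θ 4 p ![u])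
  rw [asdMatrix_swap l m t i j]
  ring

theorem dual_psi (h : IsContactCoframe θ a b c) (r : Fin 3) (i k : Fin 5) (p : E5) :
    θ i p ![psi θ (su2Forms θ r) p (frame θ k p)] = su2Matrix r i k := by
  have e : ∀ v, θ i p ![v] = covector (θ i p) v := fun v => rfl
  have hp : psi θ (su2Forms θ r) p (frame θ k p) = ∑ j, su2Matrix r j k • frame θ j p :=
    Finset.sum_congr rfl fun j _ => by rw [h.su2Forms_frame]
  have hs : ∀ j, covector (θ i p) (su2Matrix r j k • frame θ j p) =
      su2Matrix r j k * if i = j then 1 else 0 := fun j => by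
    rw [← h.dual i j p]
    exact form_one_smul _ _ _
  rw [hp, e, map_sum, Finset.sum_congr rfl fun j _ => hs j]
  simp

/-- Both conditions bear on the factor `dη` of the curvature only: anti-self-dual forms are of type
`(1,1)` and primitive for `ψ`. -/
theorem isInstanton (h : IsContactCoframe θ a b c) (l m t : ℝ) :
    IsInstanton θ (su2Forms θ 0) (instantonConn θ l m t) := by
  intro i j p
  have e : ∀ u v, curvature (instantonConn θ l m t) i j p ![u, v] = asdMatrix l m t j i *
      ∑ i, ∑ j, asdMatrix a b c i j * (θ i p ![u] * θ j p ![v]) := fun u v => by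
    rw [curvature_instantonConn, ← h.deta_apply]
    rfl
  simp only [e, h.dual, h.dual_psi]
  constructor
  · intro k k'
    congr 1
    fin_cases k <;> fin_cases k' <;> simp [asdMatrix, su2Matrix, Fin.sum_univ_five]
  · rw [← Finset.mul_sum]
    refine mul_eq_zero_of_right _ ?_
    simp [asdMatrix, su2Matrix, Fin.sum_univ_five]

theorem comp_curvature_instantonConn (h : IsContactCoframe θ a b c) (l m t : ℝ)
    (i j k k' : Fin 5) (p : E5) :
    comp θ (curvature (instantonConn θ l m t) i j) ![k, k'] p =
      asdMatrix l m t j i * asdMatrix a b c k k' := by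
  rw [comp_two, curvature_instantonConn, ← h.deta_frame p]
  rfl

theorem torsionForm_ne_zero (h : IsContactCoframe θ a b c) (habc : 0 < a ^ 2 + b ^ 2 + c ^ 2)
    (p : E5) : torsionForm θ p ≠ 0 := by
  intro h0
  have e : ∀ i j k, comp θ (torsionForm θ) ![i, j, k] p = 0 := fun i j k => by
    rw [comp, h0]; rfl
  simp only [h.comp_torsion] at e
  have ha := e 4 0 1
  have hb := e 4 0 2
  have hc := e 4 0 3
  simp [asdMatrix] at ha hb hc
  simp [ha, hb, hc] at habc

theorem wedge_volume_ne_zero (h : IsContactCoframe θ a b c) (p : E5) :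
    wedge (wedge (su2Forms θ 0) (su2Forms θ 0) : Form 4) (θ 4) p ≠ 0 := by
  refine wedge_four_one_ne_zero _ _ p (fun i => frame θ i p)
    (fun i => (h.dual 4 i p).trans (if_congr eq_comm rfl rfl))
    _ (fun i j k l => by simp only [wedge_two_two, h.su2Forms_frame]; rfl) ?_
  -- Each of the 24 signed terms is `(F₁ ∧ F₁)(E₁, E₂, E₃, E₄) = 2`.
  simp [su2Matrix]
  norm_num

theorem su2Forms_two_nonneg (h : IsContactCoframe θ a b c) (p X Y : E5)
    (hXY : ∀ Z, su2Forms θ 0 p ![X, Z] = su2Forms θ 1 p ![Y, Z]) :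
    0 ≤ su2Forms θ 2 p ![X, Y] := by
  have e : ∀ j, ∑ i, su2Matrix 0 i j * θ i p ![X] = ∑ i, su2Matrix 1 i j * θ i p ![Y] := by
    intro j
    have := hXY (frame θ j p)
    rw [su2Forms_apply, su2Forms_apply] at this
    simpa [h.dual] using this
  have e0 := e 0
  have e1 := e 1
  have e2 := e 2
  have e3 := e 3
  simp [su2Matrix, Fin.sum_univ_five] at e0 e1 e2 e3
  rw [su2Forms_apply]
  simp [su2Matrix, Fin.sum_univ_five]
  -- The hypothesis determines the horizontal part of `Y` from that of `X`, and `F₃(X, Y)` becomes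
  -- the squared length of the horizontal part of `X`.
  rw [← e0, ← e1, ← e2, e3]
  nlinarith [sq_nonneg (θ 0 p ![X]), sq_nonneg (θ 1 p ![X]), sq_nonneg (θ 1 p ![Y]),
    sq_nonneg (θ 3 p ![X])]

theorem isSU2Structure (h : IsContactCoframe θ a b c) : IsSU2Structure (θ 4) (su2Forms θ) :=
  ⟨⟨(wedge (su2Forms θ 0) (su2Forms θ 0) : Form 4), wedge_su2Forms θ, h.wedge_volume_ne_zero⟩,
    h.su2Forms_two_nonneg⟩

end IsContactCoframe

/-! ### Ricci tensor and equations of motion. -/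

/-- On the horizontal space the matrix is a combination of three anticommuting orthogonal complex
structures, like an imaginary quaternion. -/
theorem asdMatrix_mul_self (a b c : ℝ) (i j : Fin 5) :
    ∑ m, asdMatrix a b c i m * asdMatrix a b c j m =
      if i = j then (if i = 4 then 0 else a ^ 2 + b ^ 2 + c ^ 2) else 0 := by
  fin_cases i <;> fin_cases j <;> simp [asdMatrix, Fin.sum_univ_five] <;> ring

theorem sum_Ioi (f : Fin 5 → ℝ) (i : Fin 5) :
    ∑ j ∈ Finset.Ioi i, f j = ∑ j, if i < j then f j else 0 := by
  rw [← Finset.sum_filter]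
  congr 1
  ext j
  simp

theorem asdMatrix_norm (l m t : ℝ) :
    ∑ n, ∑ s ∈ Finset.Ioi n, asdMatrix l m t s n ^ 2 = 2 * (l ^ 2 + m ^ 2 + t ^ 2) := by
  simp only [sum_Ioi, Fin.sum_univ_five]
  simp [asdMatrix]
  ring

-- The Christoffel symbols are constant, so the Levi-Civita curvature consists of a multiple of `dη`
-- and quadratic terms; this is its contraction.
open IsContactCoframe in
theorem ricci_symbol (a b c : ℝ) (m n : Fin 5) :
    ∑ i, (lcSymbol a b c i n 4 * asdMatrix a b c i m +
      ∑ k, (lcSymbol a b c i k i * lcSymbol a b c k n m -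
        lcSymbol a b c i k m * lcSymbol a b c k n i)) =
      if m = n then (if m = 4 then a ^ 2 + b ^ 2 + c ^ 2 else -(a ^ 2 + b ^ 2 + c ^ 2) / 2)
      else 0 := by
  fin_cases m <;> fin_cases n <;> simp [lcSymbol, asdMatrix, Fin.sum_univ_five] <;> ring

namespace IsContactCoframe

variable {θ : Fin 5 → Form 1} {a b c : ℝ}

theorem ricci_leviCivita (h : IsContactCoframe θ a b c) (m n : Fin 5) (p : E5) :
    ricci θ (leviCivita θ) m n p =
      if m = n then (if m = 4 then a ^ 2 + b ^ 2 + c ^ 2 else -(a ^ 2 + b ^ 2 + c ^ 2) / 2)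
      else 0 := by
  rw [← ricci_symbol, ricci]
  refine Finset.sum_congr rfl fun i _ => ?_
  rw [comp_two, h.curvature_leviCivita, h.deta_frame]
  simp [h.dual]

theorem curvatureSquare_instantonConn (h : IsContactCoframe θ a b c) (l m t : ℝ) (i j : Fin 5)
    (p : E5) : curvatureSquare θ (instantonConn θ l m t) i j p =
      2 * (l ^ 2 + m ^ 2 + t ^ 2) *
        if i = j then (if i = 4 then 0 else a ^ 2 + b ^ 2 + c ^ 2) else 0 := by
  rw [← asdMatrix_mul_self, ← asdMatrix_norm, curvatureSquare, Finset.mul_sum]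
  refine Finset.sum_congr rfl fun k _ => ?_
  simp only [h.comp_curvature_instantonConn, Finset.sum_mul]
  exact Finset.sum_congr rfl fun n _ => Finset.sum_congr rfl fun s _ => by ring

theorem torsion_square (h : IsContactCoframe θ a b c) (i j : Fin 5) (p : E5) :
    ∑ m, ∑ n, comp θ (torsionForm θ) ![i, m, n] p * comp θ (torsionForm θ) ![j, m, n] p =
      if i = j then (if i = 4 then 4 * (a ^ 2 + b ^ 2 + c ^ 2) else 2 * (a ^ 2 + b ^ 2 + c ^ 2))
      else 0 := by
  simp only [h.comp_torsion]
  fin_cases i <;> fin_cases j <;> simp [asdMatrix, Fin.sum_univ_five] <;> ring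

theorem einsteinEquation (h : IsContactCoframe θ a b c) {l m t : ℝ}
    (hlt : l ^ 2 + m ^ 2 + t ^ 2 < a ^ 2 + b ^ 2 + c ^ 2) (φ₀ : ℝ) :
    EinsteinEquation θ (torsionForm θ) (fun _ => φ₀)
      (2 / (a ^ 2 + b ^ 2 + c ^ 2 - l ^ 2 - m ^ 2 - t ^ 2))
      (plusConn θ (torsionForm θ)) (instantonConn θ l m t) := by
  intro i j p
  have hφ : covDeriv θ (leviCivita θ)
      (fun I : Fin 1 → Fin 5 => frameDeriv θ (I 0) (fun _ => φ₀)) i ![j] p = 0 := by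
    rw [covDeriv_one]
    have e : ∀ k, frameDeriv θ k (fun _ => φ₀) = fun _ => 0 := fun k =>
      funext fun q => frameDeriv_const _ _ _ _
    simp [e, frameDeriv_const]
  have hr : a ^ 2 + b ^ 2 + c ^ 2 - l ^ 2 - m ^ 2 - t ^ 2 ≠ 0 := by linarith
  rw [hφ, h.plusConn_eq_instantonConn, h.curvatureSquare_instantonConn,
    h.curvatureSquare_instantonConn, h.ricci_leviCivita, h.torsion_square]
  -- Along `η`: `r - ¼ · 4r = 0`, with no curvature contribution. Horizontally: `-r/2 - ¼ · 2r =
  -- -r`, balanced by `(α'/2) r (r - s) = r`. Off the diagonal every term is zero.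
  split_ifs
  · ring
  · field_simp
    ring
  · ring

theorem fluxEquation (h : IsContactCoframe θ a b c) (φ₀ : ℝ) :
    FluxEquation θ (torsionForm θ) (fun _ => φ₀) := by
  intro j k p
  simp only [covDeriv_three]
  simp only [frameDeriv_const, h.leviCivita_frame, h.comp_torsion]
  fin_cases j <;> fin_cases k <;> simp [lcSymbol, asdMatrix, Fin.sum_univ_five] <;> ring

theorem gaugeEquation (h : IsContactCoframe θ a b c) (l m t φ₀ : ℝ) :
    GaugeEquation θ (torsionForm θ) (fun _ => φ₀) (instantonConn θ l m t) := by
  intro j x y p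
  -- Each summand vanishes separately: `∇⁺` and `A` have connection coefficients only along `E₅`,
  -- while `F^A` is horizontal with constant components.
  refine Finset.sum_eq_zero fun i _ => ?_
  rw [covDeriv_two]
  simp only [frameDeriv_const, h.plusConn_frame, h.comp_curvature_instantonConn]
  have hA : ∀ r s, instantonConn θ l m t r s p ![frame θ i p] =
      if 4 = i then asdMatrix l m t s r else 0 := fun r s => by
    rw [instantonConn_eq]
    change asdMatrix l m t s r * θ 4 p ![frame θ i p] = _
    rw [h.dual]; simp
  simp only [hA]
  split_ifs with hi
  · subst hi
    simp [asdMatrix_four_left]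
  · simp

end IsContactCoframe

/-! ### Clifford algebra and the Killing spinor equations. -/

namespace IsCliffordRep

variable {γ : Fin 5 → Matrix (Fin 4) (Fin 4) ℂ}

theorem sq (hγ : IsCliffordRep γ) (i : Fin 5) : γ i * γ i = -1 := by
  have h := hγ i i
  rw [if_pos rfl, ← two_smul ℂ] at h
  have : (2 : ℂ) • (γ i * γ i) = (2 : ℂ) • (-1) := by rw [h]; simp
  exact smul_right_injective _ two_ne_zero this

theorem anti (hγ : IsCliffordRep γ) {i j : Fin 5} (hij : i ≠ j) : γ j * γ i = -(γ i * γ j) := by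
  have h := hγ j i
  rw [if_neg (Ne.symm hij)] at h
  exact eq_neg_of_add_eq_zero_left h

theorem sq_assoc (hγ : IsCliffordRep γ) (i : Fin 5) (X : Matrix (Fin 4) (Fin 4) ℂ) :
    γ i * (γ i * X) = -X := by
  rw [← mul_assoc, hγ.sq, neg_one_mul]

theorem anti_assoc (hγ : IsCliffordRep γ) {i j : Fin 5} (hij : i ≠ j)
    (X : Matrix (Fin 4) (Fin 4) ℂ) : γ j * (γ i * X) = -(γ i * (γ j * X)) := by
  rw [← mul_assoc, hγ.anti hij, neg_mul, mul_assoc]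

/-- Spinors of negative chirality for the volume element of `ℍ` exist. -/
theorem exists_negative_spinor (hγ : IsCliffordRep γ) :
    ∃ s : Fin 4 → ℂ, s ≠ 0 ∧ (γ 0 * (γ 1 * (γ 2 * γ 3))).mulVec s = -s := by
  set vol := γ 0 * (γ 1 * (γ 2 * γ 3)) with hvol
  have hsq : vol * vol = 1 := by
    simp only [hvol, mul_assoc, hγ.anti_assoc (i := 0) (j := 1) (by decide),
      hγ.anti_assoc (i := 0) (j := 2) (by decide), hγ.anti_assoc (i := 0) (j := 3) (by decide),
      hγ.anti_assoc (i := 1) (j := 2) (by decide), hγ.anti_assoc (i := 1) (j := 3) (by decide),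
      hγ.anti_assoc (i := 2) (j := 3) (by decide), hγ.sq, mul_neg, neg_neg, mul_one]
  have hanti : vol * γ 0 = -(γ 0 * vol) := by
    simp only [hvol, mul_assoc, hγ.anti (i := 0) (j := 3) (by decide),
      hγ.anti_assoc (i := 0) (j := 1) (by decide), hγ.anti_assoc (i := 0) (j := 2) (by decide),
      mul_neg, neg_neg]
  by_cases h : vol = 1
  -- `γ 0` is invertible and anticommutes with `vol`, so it carries eigenvalue `1` to eigenvalue
  -- `-1`.
  · refine ⟨(γ 0).mulVec (Pi.single 0 1), fun h0 => ?_, ?_⟩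
    · have := congrArg (γ 0).mulVec h0
      rw [Matrix.mulVec_mulVec, hγ.sq, Matrix.mulVec_zero, Matrix.neg_mulVec,
        Matrix.one_mulVec] at this
      simpa using congrFun this 0
    · rw [Matrix.mulVec_mulVec, hanti, h, mul_one, Matrix.neg_mulVec]
  -- As `vol² = 1`, the image of `vol - 1` consists of eigenvectors for `-1`.
  · have h' : vol - 1 ≠ 0 := sub_ne_zero.2 h
    obtain ⟨v, hv⟩ : ∃ v, (vol - 1).mulVec v ≠ 0 := by
      by_contra! hall
      exact h' (Matrix.ext_of_mulVec_single fun i => by rw [hall, Matrix.zero_mulVec])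
    refine ⟨(vol - 1).mulVec v, hv, ?_⟩
    rw [Matrix.mulVec_mulVec, mul_sub, hsq, ← Matrix.neg_mulVec, mul_one, neg_sub]

/-- Anti-self-dual horizontal 2-forms annihilate the spinors of negative chirality. -/
theorem asd_mulVec (hγ : IsCliffordRep γ) {s : Fin 4 → ℂ}
    (hs : (γ 0 * (γ 1 * (γ 2 * γ 3))).mulVec s = -s) (a b c : ℝ) :
    ∑ i, ∑ j, ((asdMatrix a b c i j : ℝ) : ℂ) • (γ i * γ j).mulVec s = 0 := by
  -- Multiplying the chirality equation by `γ i * γ j` expresses the action of the complementary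
  -- pair: on `s`, `e³⁴` acts as `e¹²`, `e²⁴` as `-e¹³` and `e²³` as `e¹⁴`.
  have key : ∀ X Y : Matrix (Fin 4) (Fin 4) ℂ, X * (γ 0 * (γ 1 * (γ 2 * γ 3))) = Y →
      Y.mulVec s = -X.mulVec s := by
    rintro X _ rfl
    rw [← Matrix.mulVec_mulVec, hs, Matrix.mulVec_neg]
  have h1 := key (γ 0 * γ 1) (-(γ 2 * γ 3)) (by
    simp only [mul_assoc, hγ.sq_assoc, hγ.anti_assoc (i := 0) (j := 1) (by decide),
      mul_neg, neg_neg])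
  have h2 := key (γ 0 * γ 2) (γ 1 * γ 3) (by
    simp only [mul_assoc, hγ.sq_assoc, hγ.anti_assoc (i := 0) (j := 2) (by decide),
      hγ.anti_assoc (i := 1) (j := 2) (by decide), mul_neg, neg_neg])
  have h3 := key (γ 0 * γ 3) (-(γ 1 * γ 2)) (by
    simp only [mul_assoc, hγ.sq_assoc, hγ.anti_assoc (i := 0) (j := 3) (by decide),
      hγ.anti_assoc (i := 1) (j := 3) (by decide), hγ.anti_assoc (i := 2) (j := 3) (by decide),
      hγ.sq, mul_neg, neg_neg, mul_one])
  rw [Matrix.neg_mulVec, neg_inj] at h1 h3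
  have a10 : (γ 1 * γ 0).mulVec s = -(γ 0 * γ 1).mulVec s := by
    rw [hγ.anti (by decide), Matrix.neg_mulVec]
  have a20 : (γ 2 * γ 0).mulVec s = -(γ 0 * γ 2).mulVec s := by
    rw [hγ.anti (by decide), Matrix.neg_mulVec]
  have a30 : (γ 3 * γ 0).mulVec s = -(γ 0 * γ 3).mulVec s := by
    rw [hγ.anti (by decide), Matrix.neg_mulVec]
  have a21 : (γ 2 * γ 1).mulVec s = -(γ 1 * γ 2).mulVec s := by
    rw [hγ.anti (by decide), Matrix.neg_mulVec]
  have a31 : (γ 3 * γ 1).mulVec s = -(γ 1 * γ 3).mulVec s := by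
    rw [hγ.anti (by decide), Matrix.neg_mulVec]
  have a32 : (γ 3 * γ 2).mulVec s = -(γ 2 * γ 3).mulVec s := by
    rw [hγ.anti (by decide), Matrix.neg_mulVec]
  simp only [Fin.sum_univ_five]
  simp only [asdMatrix, a10, a20, a30, a21, a31, a32, h1, h2, h3]
  simp
  module

theorem asd_comm_four (hγ : IsCliffordRep γ) (a b c : ℝ) (i j : Fin 5) (s : Fin 4 → ℂ) :
    ((asdMatrix a b c i j : ℝ) : ℂ) • (γ i * γ j * γ 4).mulVec s =
      ((asdMatrix a b c i j : ℝ) : ℂ) • (γ 4 * γ i * γ j).mulVec s := by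
  by_cases hi : i = 4
  · simp [hi, asdMatrix_four_left]
  by_cases hj : j = 4
  · simp [hj, asdMatrix_four_right]
  rw [hγ.anti hi, neg_mul, mul_assoc (γ i) (γ 4), hγ.anti hj, mul_neg, neg_neg, mul_assoc]

theorem asd_comm_four' (hγ : IsCliffordRep γ) (a b c : ℝ) (i j : Fin 5) (s : Fin 4 → ℂ) :
    ((asdMatrix a b c i j : ℝ) : ℂ) • (γ i * γ 4 * γ j).mulVec s =
      -(((asdMatrix a b c i j : ℝ) : ℂ) • (γ 4 * γ i * γ j).mulVec s) := by
  by_cases hi : i = 4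
  · simp [hi, asdMatrix_four_left]
  rw [hγ.anti hi, neg_mul, Matrix.neg_mulVec, smul_neg, neg_neg]

end IsCliffordRep

namespace IsContactCoframe

variable {θ : Fin 5 → Form 1} {a b c : ℝ}

/-- In each of the three places `η` can take in `η ∧ dη`, moving `γ 4` to the front leaves, up to
sign, `γ 4` applied to the action of `dη`, which kills `s`. -/
theorem cliff3_torsionForm (h : IsContactCoframe θ a b c)
    {γ : Fin 5 → Matrix (Fin 4) (Fin 4) ℂ} (hγ : IsCliffordRep γ) {s : Fin 4 → ℂ}
    (hs : (γ 0 * (γ 1 * (γ 2 * γ 3))).mulVec s = -s) (p : E5) :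
    cliff3 θ γ (torsionForm θ) p s = 0 := by
  have h0 : ∑ i, ∑ j, ((asdMatrix a b c i j : ℝ) : ℂ) • (γ 4 * γ i * γ j).mulVec s = 0 := by
    have := congrArg (γ 4).mulVec (hγ.asd_mulVec hs a b c)
    simpa only [Matrix.mulVec_sum, Matrix.mulVec_smul, Matrix.mulVec_mulVec, Matrix.mulVec_zero,
      mul_assoc] using this
  have e : ∀ i j k, ((comp θ (torsionForm θ) ![i, j, k] p : ℝ) : ℂ) • (γ i * γ j * γ k).mulVec s =
      (if 4 = i then ((asdMatrix a b c j k : ℝ) : ℂ) • (γ i * γ j * γ k).mulVec s else 0) -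
      (if 4 = j then ((asdMatrix a b c i k : ℝ) : ℂ) • (γ i * γ j * γ k).mulVec s else 0) +
      (if 4 = k then ((asdMatrix a b c i j : ℝ) : ℂ) • (γ i * γ j * γ k).mulVec s else 0) := by
    intro i j k
    rw [h.comp_torsion]
    split_ifs <;> simp [add_smul, sub_smul]
  have s1 : ∑ i, ∑ j, ∑ k, (if 4 = i then
      ((asdMatrix a b c j k : ℝ) : ℂ) • (γ i * γ j * γ k).mulVec s else 0) = 0 := by
    rw [Finset.sum_eq_single_of_mem 4 (Finset.mem_univ _) fun i _ hi => by simp [Ne.symm hi]]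
    simpa using h0
  have s2 : ∑ i, ∑ j, ∑ k, (if 4 = j then
      ((asdMatrix a b c i k : ℝ) : ℂ) • (γ i * γ j * γ k).mulVec s else 0) = 0 := by
    rw [Finset.sum_comm,
      Finset.sum_eq_single_of_mem 4 (Finset.mem_univ _) fun i _ hi => by simp [Ne.symm hi]]
    simp only [if_true, hγ.asd_comm_four', Finset.sum_neg_distrib, h0, neg_zero]
  have s3 : ∑ i, ∑ j, ∑ k, (if 4 = k then
      ((asdMatrix a b c i j : ℝ) : ℂ) • (γ i * γ j * γ k).mulVec s else 0) = 0 := by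
    simpa only [Finset.sum_ite_eq, Finset.mem_univ, if_true, hγ.asd_comm_four] using h0
  rw [cliff3]
  simp only [e, Finset.sum_add_distrib, Finset.sum_sub_distrib, s1, s2, s3]
  simp

/-- The spinor is constant in the frame, so its derivative drops out and each equation reduces to an
anti-self-dual form acting by zero. -/
theorem supersymmetryEquations (h : IsContactCoframe θ a b c)
    {γ : Fin 5 → Matrix (Fin 4) (Fin 4) ℂ} (hγ : IsCliffordRep γ) (l m t φ₀ : ℝ) :
    SupersymmetryEquations θ γ (torsionForm θ) (fun _ => φ₀) (instantonConn θ l m t) := by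
  obtain ⟨s, hs0, hs⟩ := hγ.exists_negative_spinor
  refine ⟨fun _ => s, contDiff_const, fun _ => hs0, fun p => ⟨fun m => ?_, ?_, fun x y => ?_⟩⟩
  · rw [spinorDeriv]
    simp only [h.plusConn_frame]
    split_ifs
    · rw [hγ.asd_mulVec hs]
      simp
    · simp
  · rw [h.cliff3_torsionForm hγ hs]
    simp [frameDeriv_const]
  · simp only [h.comp_curvature_instantonConn, Complex.ofReal_mul]
    have := congrArg (fun v => ((asdMatrix l m t y x : ℝ) : ℂ) • v) (hγ.asd_mulVec hs a b c)
    simpa only [Finset.smul_sum, smul_smul, smul_zero] using this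

end IsContactCoframe

/-! ### The explicit coframe, its dual frame and its metric. -/

/-- The values of `dx₁, dy₁, dx₂, dy₂, x₁ dy₁ + x₂ dy₂ - dz` on the coordinate basis. -/
def contactMatrix (p : E5) : Matrix (Fin 5) (Fin 5) ℝ :=
  !![1, 0, 0, 0, 0;
     0, 1, 0, 0, 0;
     0, 0, 1, 0, 0;
     0, 0, 0, 1, 0;
     0, p 0, 0, p 2, -1]

theorem contactMatrix_mul_self (p : E5) : contactMatrix p * contactMatrix p = 1 := by
  ext i j
  fin_cases i <;> fin_cases j <;> simp [contactMatrix, Matrix.mul_apply, Fin.sum_univ_five]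

open Classical in
/-- The components of the coframe in the basis `dx₁, dy₁, dx₂, dy₂, x₁ dy₁ + x₂ dy₂ - dz`. -/
def coframeMatrix (a b c : ℝ) : Matrix (Fin 5) (Fin 5) ℝ :=
  if a = 0 ∧ b = 0 then
    !![1, 0, 0, 0, 0;
       0, 0, 0, 1, 0;
       0, 0, 1, 0, 0;
       0, 1, 0, 0, 0;
       0, 0, 0, 0, c]
  else
    !![a ^ 2 + b ^ 2 + c ^ 2, 0, 0, 0, 0;
       0, a, b * (1 + c ^ 2 / (a ^ 2 + b ^ 2)), -(a * c), 0;
       0, b, -(a * (1 + c ^ 2 / (a ^ 2 + b ^ 2))), -(b * c), 0;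
       0, c, 0, a ^ 2 + b ^ 2, 0;
       0, 0, 0, 0, (a ^ 2 + b ^ 2 + c ^ 2) ^ 2]

/-- The coefficients of the metric in the basis `dx₁, dy₁, dx₂, dy₂, x₁ dy₁ + x₂ dy₂ - dz`. -/
def metricCoeff (a b c : ℝ) : Fin 5 → ℝ := fun s => ∑ i, coframeMatrix a b c i s ^ 2

theorem contactForm_apply (p u : E5) : contactForm p ![u] = p 0 * u 1 + p 2 * u 3 - u 4 := by
  change p 0 * dcoord 1 p ![u] + p 2 * dcoord 3 p ![u] - dcoord 4 p ![u] = _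
  simp only [dcoord_apply]

theorem coframe_apply (a b c : ℝ) (i : Fin 5) (p u : E5) :
    coframe a b c i p ![u] = ∑ s, coframeMatrix a b c i s *
      (![u 0, u 1, u 2, u 3, p 0 * u 1 + p 2 * u 3 - u 4] : E5) s := by
  by_cases h : a = 0 ∧ b = 0
  · rw [coframe, coframeMatrix, if_pos h, if_pos h]
    fin_cases i <;> simp [Fin.sum_univ_five, dcoord_apply, contactForm_apply]
  · rw [coframe, coframeMatrix, if_neg h, if_neg h]
    fin_cases i <;> simp [Fin.sum_univ_five, dcoord_apply, contactForm_apply]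
    · ring
    · ring

theorem coframe_of (a b c : ℝ) (p : E5) :
    (Matrix.of fun r s : Fin 5 => coframe a b c r p ![Pi.single s 1]) =
      coframeMatrix a b c * contactMatrix p := by
  ext r s
  simp only [Matrix.of_apply, coframe_apply, Matrix.mul_apply]
  refine Finset.sum_congr rfl fun k _ => ?_
  congr 1
  fin_cases k <;> fin_cases s <;> simp [contactMatrix]

theorem add_sq_pos_of_not {a b : ℝ} (h : ¬(a = 0 ∧ b = 0)) : 0 < a ^ 2 + b ^ 2 := by
  by_contra hn
  exact h ⟨by nlinarith [sq_nonneg a, sq_nonneg b], by nlinarith [sq_nonneg a, sq_nonneg b]⟩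

theorem metricCoeff_of_ne {a b : ℝ} (h : ¬(a = 0 ∧ b = 0)) (c : ℝ) :
    metricCoeff a b c = ![(a ^ 2 + b ^ 2 + c ^ 2) ^ 2, a ^ 2 + b ^ 2 + c ^ 2,
      (a ^ 2 + b ^ 2 + c ^ 2) ^ 2 / (a ^ 2 + b ^ 2),
      (a ^ 2 + b ^ 2 + c ^ 2) * (a ^ 2 + b ^ 2), (a ^ 2 + b ^ 2 + c ^ 2) ^ 4] := by
  have hq := (add_sq_pos_of_not h).ne'
  funext s
  rw [metricCoeff, coframeMatrix, if_neg h]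
  fin_cases s <;> simp [Fin.sum_univ_five]
  · field_simp
    ring
  · ring
  · ring

theorem metricCoeff_zero (c : ℝ) : metricCoeff 0 0 c = ![1, 1, 1, 1, c ^ 2] := by
  funext s
  rw [metricCoeff, coframeMatrix, if_pos ⟨rfl, rfl⟩]
  fin_cases s <;> simp [Fin.sum_univ_five]

theorem metricCoeff_ne_zero {a b c : ℝ} (habc : 0 < a ^ 2 + b ^ 2 + c ^ 2) (s : Fin 5) :
    metricCoeff a b c s ≠ 0 := by
  by_cases h : a = 0 ∧ b = 0
  · obtain ⟨rfl, rfl⟩ := h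
    rw [metricCoeff_zero]
    have : c ≠ 0 := by rintro rfl; simp at habc
    fin_cases s <;> simp [this]
  · have hq := (add_sq_pos_of_not h).ne'
    rw [metricCoeff_of_ne h]
    fin_cases s <;> simp [hq, habc.ne']

/-- Orthogonality of the columns makes the metric diagonal in the contact basis, and makes the
inverse of `coframeMatrix` a rescaled transpose. -/
theorem coframeMatrix_gram (a b c : ℝ) (s t : Fin 5) :
    ∑ i, coframeMatrix a b c i s * coframeMatrix a b c i t =
      if s = t then metricCoeff a b c s else 0 := by
  split_ifs with hst
  · subst hst
    exact Finset.sum_congr rfl fun i _ => (sq _).symm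
  · by_cases h : a = 0 ∧ b = 0
    · rw [coframeMatrix, if_pos h]
      fin_cases s <;> fin_cases t <;> simp [Fin.sum_univ_five] at hst ⊢
    · have hq := (add_sq_pos_of_not h).ne'
      rw [coframeMatrix, if_neg h]
      fin_cases s <;> fin_cases t <;> simp [Fin.sum_univ_five] at hst ⊢ <;> ring

theorem metric_coframe (a b c : ℝ) (p u v : E5) :
    metric (coframe a b c) p u v = ∑ s, metricCoeff a b c s *
      ((![u 0, u 1, u 2, u 3, p 0 * u 1 + p 2 * u 3 - u 4] : E5) s *
        (![v 0, v 1, v 2, v 3, p 0 * v 1 + p 2 * v 3 - v 4] : E5) s) := by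
  simp only [metric, coframe_apply]
  generalize (![u 0, u 1, u 2, u 3, p 0 * u 1 + p 2 * u 3 - u 4] : E5) = x
  generalize (![v 0, v 1, v 2, v 3, p 0 * v 1 + p 2 * v 3 - v 4] : E5) = y
  have h : ∀ s, metricCoeff a b c s * (x s * y s) = ∑ t, ∑ i,
      coframeMatrix a b c i s * coframeMatrix a b c i t * (x s * y t) := fun s => by
    simp only [← Finset.sum_mul, coframeMatrix_gram]
    simp
  simp only [h, Finset.sum_mul_sum]
  rw [Finset.sum_comm]
  refine Finset.sum_congr rfl fun s _ => ?_
  rw [Finset.sum_comm]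
  exact Finset.sum_congr rfl fun t _ => Finset.sum_congr rfl fun i _ => by ring

/-- The inverse of `coframeMatrix`. -/
def coframeMatrixInv (a b c : ℝ) : Matrix (Fin 5) (Fin 5) ℝ :=
  Matrix.of fun s i => (metricCoeff a b c s)⁻¹ * coframeMatrix a b c i s

theorem coframeMatrixInv_mul {a b c : ℝ} (habc : 0 < a ^ 2 + b ^ 2 + c ^ 2) :
    coframeMatrixInv a b c * coframeMatrix a b c = 1 := by
  ext s t
  simp only [Matrix.mul_apply, coframeMatrixInv, Matrix.of_apply, mul_assoc, ← Finset.mul_sum,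
    coframeMatrix_gram, Matrix.one_apply]
  split_ifs
  · exact inv_mul_cancel₀ (metricCoeff_ne_zero habc s)
  · simp

/-- The matrix of the coframe is a constant matrix times the involution `contactMatrix p`; hence the
frame depends on `p` only through entries that are affine in the coordinates. -/
theorem frame_coframe {a b c : ℝ} (habc : 0 < a ^ 2 + b ^ 2 + c ^ 2) (i k : Fin 5) (p : E5) :
    frame (coframe a b c) i p k = (contactMatrix p * coframeMatrixInv a b c) k i := by
  rw [frame, coframe_of,
    Matrix.inv_eq_left_inv (B := contactMatrix p * coframeMatrixInv a b c)]
  rw [Matrix.mul_assoc, ← Matrix.mul_assoc (coframeMatrixInv a b c), coframeMatrixInv_mul habc,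
    Matrix.one_mul, contactMatrix_mul_self]

theorem coframe_dual {a b c : ℝ} (habc : 0 < a ^ 2 + b ^ 2 + c ^ 2) (i j : Fin 5) (p : E5) :
    coframe a b c i p ![frame (coframe a b c) j p] = if i = j then 1 else 0 := by
  have h : coframeMatrix a b c * contactMatrix p * (contactMatrix p * coframeMatrixInv a b c) =
      1 := by
    rw [Matrix.mul_assoc, ← Matrix.mul_assoc (contactMatrix p), contactMatrix_mul_self,
      Matrix.one_mul]
    exact mul_eq_one_comm.1 (coframeMatrixInv_mul habc)
  rw [form_one_expand, ← Matrix.one_apply, ← h, ← coframe_of]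
  simp only [frame_coframe habc]
  rfl

theorem contDiff_contactForm : ContDiff ℝ ∞ contactForm := by
  have h : ∀ i, ContDiff ℝ ∞ (dcoord i) := fun i => contDiff_const
  have hp : ∀ i : Fin 5, ContDiff ℝ ∞ fun p : E5 => p i := fun i => contDiff_apply ℝ ℝ i
  exact (((hp 0).smul (h 1)).add ((hp 2).smul (h 3))).sub (h 4)

theorem contDiff_coframe (a b c : ℝ) (i : Fin 5) : ContDiff ℝ ∞ (coframe a b c i) := by
  have h : ∀ i, ContDiff ℝ ∞ (dcoord i) := fun i => contDiff_const
  have hs : ∀ (x : ℝ) {α : Form 1}, ContDiff ℝ ∞ α → ContDiff ℝ ∞ (x • α) := fun x α hα =>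
    contDiff_const.smul hα
  by_cases h0 : a = 0 ∧ b = 0
  · rw [coframe, if_pos h0]
    fin_cases i
    · exact h 0
    · exact h 3
    · exact h 2
    · exact h 1
    · exact hs _ contDiff_contactForm
  · rw [coframe, if_neg h0]
    fin_cases i
    · exact hs _ (h 0)
    · exact ((hs _ (h 1)).add (hs _ (h 2))).sub (hs _ (h 3))
    · exact ((hs _ (h 1)).sub (hs _ (h 2))).sub (hs _ (h 3))
    · exact (hs _ (h 1)).add (hs _ (h 3))
    · exact hs _ contDiff_contactForm

theorem differentiable_frame_coframe {a b c : ℝ} (habc : 0 < a ^ 2 + b ^ 2 + c ^ 2) (i : Fin 5) :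
    Differentiable ℝ (frame (coframe a b c) i) := by
  refine differentiable_pi.2 fun k => ?_
  simp only [frame_coframe habc, Matrix.mul_apply]
  refine Differentiable.fun_sum fun s _ => Differentiable.mul_const ?_ _
  have hp : ∀ i : Fin 5, Differentiable ℝ fun p : E5 => p i := fun i => differentiable_apply i
  fin_cases k <;> fin_cases s <;> simp [contactMatrix] <;> exact hp _

theorem coframeMatrix_four (a b c : ℝ) {i : Fin 5} (hi : i ≠ 4) : coframeMatrix a b c i 4 = 0 := by
  by_cases h : a = 0 ∧ b = 0
  · rw [coframeMatrix, if_pos h]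
    fin_cases i <;> simp at hi ⊢
  · rw [coframeMatrix, if_neg h]
    fin_cases i <;> simp at hi ⊢

theorem coframe_const (a b c : ℝ) {i : Fin 5} (hi : i ≠ 4) (p q : E5) :
    coframe a b c i p = coframe a b c i q := by
  ext v
  rw [vec_one v, coframe_apply, coframe_apply]
  simp [Fin.sum_univ_five, coframeMatrix_four a b c hi]

theorem extDeriv_contactForm (p u v : E5) :
    extDeriv contactForm p ![u, v] = u 0 * v 1 - v 0 * u 1 + (u 2 * v 3 - v 2 * u 3) := by
  rw [extDeriv_one_apply p (contDiff_contactForm.differentiable (by simp) p)]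
  have hp : ∀ i : Fin 5, HasFDerivAt (fun p : E5 => p i) (ContinuousLinearMap.proj i) p :=
    fun i => (ContinuousLinearMap.proj (R := ℝ) (φ := fun _ : Fin 5 => ℝ) i).hasFDerivAt
  have h : ∀ x y : E5, fderiv ℝ (fun q => contactForm q ![x]) p y = y 0 * x 1 + y 2 * x 3 := by
    intro x y
    have := ((((hp 0).mul_const (x 1)).add ((hp 2).mul_const (x 3))).sub_const (x 4)).fderiv
    simp only [contactForm_apply]
    refine (congrArg (fun L => L y) this).trans ?_
    simp
    ring
  rw [h, h]
  ring

/-- `dη` is a multiple of `dx₁ ∧ dy₁ + dx₂ ∧ dy₂`, so the claim is a polynomial identity once `a² +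
b²` is cleared. -/
theorem coframe_structureEq (a b c : ℝ) :
    extDeriv (coframe a b c 4) =
      a • (e2 (coframe a b c) 0 1 - e2 (coframe a b c) 2 3) +
      b • (e2 (coframe a b c) 0 2 + e2 (coframe a b c) 1 3) +
      c • (e2 (coframe a b c) 0 3 - e2 (coframe a b c) 1 2) := by
  refine form_ext_two fun p u v => ?_
  change _ = a * (e2 (coframe a b c) 0 1 p ![u, v] - e2 (coframe a b c) 2 3 p ![u, v]) +
    b * (e2 (coframe a b c) 0 2 p ![u, v] + e2 (coframe a b c) 1 3 p ![u, v]) +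
    c * (e2 (coframe a b c) 0 3 p ![u, v] - e2 (coframe a b c) 1 2 p ![u, v])
  have hs : ∀ x : ℝ, extDeriv (x • contactForm) p ![u, v] =
      x * (u 0 * v 1 - v 0 * u 1 + (u 2 * v 3 - v 2 * u 3)) := fun x => by
    rw [extDeriv_smul, ← extDeriv_contactForm p]
    rfl
  simp only [e2_apply, coframe_apply, Fin.sum_univ_five]
  by_cases h : a = 0 ∧ b = 0
  · have e4 : coframe a b c 4 = c • contactForm := by rw [coframe, if_pos h]; rfl
    rw [e4, hs, coframeMatrix, if_pos h]
    simp [h.1, h.2, -mul_eq_mul_left_iff]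
    ring
  · have hq := (add_sq_pos_of_not h).ne'
    have e4 : coframe a b c 4 = (a ^ 2 + b ^ 2 + c ^ 2) ^ 2 • contactForm := by
      rw [coframe, if_neg h]; rfl
    rw [e4, hs, coframeMatrix, if_neg h]
    simp
    field_simp
    ring

theorem isContactCoframe_coframe {a b c : ℝ} (habc : 0 < a ^ 2 + b ^ 2 + c ^ 2) :
    IsContactCoframe (coframe a b c) a b c where
  dual := coframe_dual habc
  differentiable_frame := differentiable_frame_coframe habc
  differentiable i := (contDiff_coframe a b c i).differentiable (by simp)
  const _ hi := coframe_const a b c hi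
  structureEq := coframe_structureEq a b c

/-! ### Left invariance. -/

theorem leftTrans_eq (h : H21) : leftTrans h = heisMul (coord h) := by
  funext p
  rw [leftTrans, coord_mul, coord_ofCoord]

theorem contDiff_heisMul (g : E5) : ContDiff ℝ ∞ (heisMul g) := by
  have hp : ∀ i : Fin 5, ContDiff ℝ ∞ fun p : E5 => p i := fun i => contDiff_apply ℝ ℝ i
  refine contDiff_pi.2 fun i => ?_
  fin_cases i
  · exact contDiff_const.add (hp 0)
  · exact contDiff_const.add (hp 1)
  · exact contDiff_const.add (hp 2)
  · exact contDiff_const.add (hp 3)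
  · exact ((contDiff_const.add (hp 4)).add (contDiff_const.mul (hp 1))).add
      (contDiff_const.mul (hp 3))

theorem fderiv_heisMul (g p u : E5) :
    fderiv ℝ (heisMul g) p u = ![u 0, u 1, u 2, u 3, u 4 + g 0 * u 1 + g 2 * u 3] := by
  have hp : ∀ i : Fin 5, HasFDerivAt (fun p : E5 => p i) (ContinuousLinearMap.proj i) p :=
    fun i => (ContinuousLinearMap.proj (R := ℝ) (φ := fun _ : Fin 5 => ℝ) i).hasFDerivAt
  funext k
  have hd : DifferentiableAt ℝ (heisMul g) p := (contDiff_heisMul g).differentiable (by simp) p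
  have hk : fderiv ℝ (heisMul g) p u k = fderiv ℝ (fun q => heisMul g q k) p u := by
    rw [fderiv_apply hd]
    rfl
  rw [hk]
  have h4 := (((hp 4).const_add (g 4)).add ((hp 1).const_mul (g 0))).add ((hp 3).const_mul (g 2))
  fin_cases k
  · exact (congrArg (fun L => L u) ((hp 0).const_add (g 0)).fderiv).trans rfl
  · exact (congrArg (fun L => L u) ((hp 1).const_add (g 1)).fderiv).trans rfl
  · exact (congrArg (fun L => L u) ((hp 2).const_add (g 2)).fderiv).trans rfl
  · exact (congrArg (fun L => L u) ((hp 3).const_add (g 3)).fderiv).trans rfl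
  · exact (congrArg (fun L => L u) h4.fderiv).trans rfl

/-- The coefficients over the contact basis are constant, and that basis is invariant: the change of
`dz` under translation compensates the shifts of `x₁` and `x₂`. -/
theorem coframe_leftTrans (a b c : ℝ) (h : H21) (i : Fin 5) (p u : E5) :
    coframe a b c i (leftTrans h p) ![fderiv ℝ (leftTrans h) p u] = coframe a b c i p ![u] := by
  rw [leftTrans_eq, fderiv_heisMul, coframe_apply, coframe_apply]
  refine Finset.sum_congr rfl fun s _ => ?_
  congr 1
  fin_cases s <;> simp [heisMul]
  ring

theorem isLeftInvariantCoframe_coframe {a b c : ℝ} (habc : 0 < a ^ 2 + b ^ 2 + c ^ 2) :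
    IsLeftInvariantCoframe (coframe a b c) :=
  ⟨contDiff_coframe a b c, coframe_dual habc, coframe_leftTrans a b c⟩

/-! ### Topology of the nilmanifold. -/

theorem continuous_heisMatrix : Continuous heisMatrix := by
  refine continuous_matrix fun i j => ?_
  fin_cases i <;> fin_cases j <;> simp [heisMatrix] <;> fun_prop

theorem continuous_heisInv : Continuous heisInv := by
  refine continuous_pi fun i => ?_
  fin_cases i <;> simp [heisInv] <;> fun_prop

theorem continuous_ofCoord : Continuous ofCoord := by
  have h : Continuous heisUnit :=
    Units.continuous_iff.2 ⟨continuous_heisMatrix, continuous_heisMatrix.comp continuous_heisInv⟩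
  exact h.subtype_mk _

theorem continuous_coord : Continuous coord := by
  have h : Continuous entries := Units.continuous_val.comp continuous_subtype_val
  have he : ∀ i j, Continuous fun A : H21 => entries A i j := fun i j =>
    (continuous_apply_apply i j).comp h
  refine continuous_pi fun i => ?_
  fin_cases i
  · exact he 0 1
  · exact he 1 3
  · exact he 0 2
  · exact he 2 3
  · exact he 0 3

/-- The global coordinates as a homeomorphism. -/
def coordHomeomorph : E5 ≃ₜ H21 where
  toFun := ofCoord
  invFun := coord
  left_inv := coord_ofCoord
  right_inv := ofCoord_coord
  continuous_toFun := continuous_ofCoord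
  continuous_invFun := continuous_coord

/-- The open cube `|x k| < 1` contains no integer point other than the origin. -/
theorem discreteTopology_Gamma21 : DiscreteTopology Gamma21 := by
  refine discreteTopology_of_isOpen_singleton_one ?_
  have hc : Continuous fun g : Gamma21 => coord (g : H21) :=
    continuous_coord.comp continuous_subtype_val
  have hU : IsOpen {x : E5 | ∀ k, |x k| < 1} := by
    simp only [Set.ofPred_forall]
    exact isOpen_iInter_of_finite fun k => isOpen_lt (by fun_prop) continuous_const
  convert! hU.preimage hc
  ext g
  simp only [Set.mem_singleton_iff, Set.mem_preimage, Set.mem_ofPred_eq]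
  constructor
  · rintro rfl k
    have : coord (1 : H21) = 0 := by
      rw [← ofCoord_zero, coord_ofCoord]
    simp [this]
  · intro hg
    have h0 : coord (g : H21) = 0 := by
      funext k
      obtain ⟨n, hn⟩ := (integral_iff (g : H21)).1 g.2 k
      have := hg k
      rw [hn] at this ⊢
      have : |n| < 1 := by exact_mod_cast this
      rw [Int.abs_lt_one_iff.1 this]
      simp
    apply Subtype.ext
    rw [← ofCoord_coord (g : H21), h0, ofCoord_zero]
    rfl

theorem isQuotientCoveringMap_mk :
    IsQuotientCoveringMap (Quotient.mk (MulAction.orbitRel Gamma21 H21)) Gamma21 := by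
  refine isQuotientMap_quotient_mk'.isQuotientCoveringMap_of_subgroup Gamma21
    (isDiscrete_iff_discreteTopology.2 discreteTopology_Gamma21) ?_
  intro A B
  exact Quotient.eq''.trans QuotientGroup.rightRel_apply

theorem isCoveringMap_nilProj : IsCoveringMap nilProj :=
  isQuotientCoveringMap_mk.isCoveringMap.comp_homeomorph coordHomeomorph

theorem surjective_nilProj : Function.Surjective nilProj := by
  rintro ⟨A⟩
  exact ⟨coord A, congrArg _ (ofCoord_coord A)⟩

theorem isOpenQuotientMap_nilProj : IsOpenQuotientMap nilProj :=
  ⟨surjective_nilProj, isCoveringMap_nilProj.continuous, isCoveringMap_nilProj.isOpenMap⟩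

/-- A lattice element in coordinates. -/
abbrev intVec (n : Fin 5 → ℤ) : E5 := fun k => n k

theorem ofCoord_intVec_mem (n : Fin 5 → ℤ) : ofCoord (intVec n) ∈ Gamma21 :=
  (integral_iff _).2 fun k => ⟨n k, by rw [coord_ofCoord]⟩

theorem nilProj_eq_iff {p q : E5} :
    nilProj p = nilProj q ↔ ∃ n : Fin 5 → ℤ, p = heisMul (intVec n) q := by
  refine Quotient.eq''.trans (MulAction.orbitRel_apply.trans ⟨?_, ?_⟩)
  · rintro ⟨g, hg⟩
    have hg' : (g : H21) * ofCoord q = ofCoord p := hg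
    choose n hn using (integral_iff (g : H21)).1 g.2
    refine ⟨n, ?_⟩
    have h : coord (g : H21) = intVec n := funext hn
    rw [← coord_ofCoord p, ← hg', coord_mul, coord_ofCoord, h]
  · rintro ⟨n, rfl⟩
    exact ⟨⟨_, ofCoord_intVec_mem n⟩, ofCoord_mul _ _⟩

theorem nilProj_heisMul (n : Fin 5 → ℤ) (p : E5) : nilProj (heisMul (intVec n) p) = nilProj p :=
  nilProj_eq_iff.2 ⟨n, rfl⟩

theorem compactSpace_N21 : CompactSpace N21 := by
  have hK : IsCompact (Set.Icc (0 : E5) 1) := isCompact_Icc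
  have h := hK.image isCoveringMap_nilProj.continuous
  have hu : nilProj '' Set.Icc (0 : E5) 1 = Set.univ := by
    refine Set.eq_univ_of_forall fun q => ?_
    obtain ⟨p, rfl⟩ := surjective_nilProj q
    have hfl : ∀ x : ℝ, 0 ≤ -(⌊x⌋ : ℝ) + x ∧ -(⌊x⌋ : ℝ) + x ≤ 1 := fun x =>
      ⟨by linarith [Int.floor_le x], by linarith [Int.lt_floor_add_one x]⟩
    -- The first four integers bring the base coordinates into the unit cube; translation by them
    -- shears `z`, so the last integer is read off from the sheared value.
    set n : Fin 5 → ℤ := ![-⌊p 0⌋, -⌊p 1⌋, -⌊p 2⌋, -⌊p 3⌋,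
      -⌊p 4 + -(⌊p 0⌋ : ℝ) * p 1 + -(⌊p 2⌋ : ℝ) * p 3⌋] with hn
    refine ⟨heisMul (intVec n) p, ?_, nilProj_heisMul n p⟩
    have key : ∀ k, 0 ≤ heisMul (intVec n) p k ∧ heisMul (intVec n) p k ≤ 1 := by
      intro k
      fin_cases k
      · simpa [heisMul, hn, intVec] using hfl (p 0)
      · simpa [heisMul, hn, intVec] using hfl (p 1)
      · simpa [heisMul, hn, intVec] using hfl (p 2)
      · simpa [heisMul, hn, intVec] using hfl (p 3)
      · have := hfl (p 4 + -(⌊p 0⌋ : ℝ) * p 1 + -(⌊p 2⌋ : ℝ) * p 3)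
        have e : heisMul (intVec n) p 4 = -(⌊p 4 + -(⌊p 0⌋ : ℝ) * p 1 + -(⌊p 2⌋ : ℝ) * p 3⌋ : ℝ) +
            (p 4 + -(⌊p 0⌋ : ℝ) * p 1 + -(⌊p 2⌋ : ℝ) * p 3) := by
          simp only [heisMul, hn, intVec]
          simp
          ring
        exact e ▸ this
    exact ⟨fun k => (key k).1, fun k => (key k).2⟩
  exact ⟨hu ▸ h⟩

theorem connectedSpace_N21 : ConnectedSpace N21 :=
  surjective_nilProj.connectedSpace isCoveringMap_nilProj.continuous

/-- A discrete subgroup acts properly discontinuously on the locally compact Hausdorff group. -/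
theorem t2Space_N21 : T2Space N21 := by
  have := discreteTopology_Gamma21
  have : LocallyCompactSpace H21 := coordHomeomorph.symm.isClosedEmbedding.locallyCompactSpace
  have : ProperlyDiscontinuousSMul Gamma21 H21 :=
    Gamma21.properlyDiscontinuousSMul_of_tendsto_cofinite
      (Gamma21.tendsto_coe_cofinite_of_discrete
        (isDiscrete_iff_discreteTopology.2 discreteTopology_Gamma21))
  exact t2Space_of_properlyDiscontinuousSMul_of_t2Space

/-! ### The circle bundle -/

theorem torusProj_nilProj (p : E5) :
    torusProj (nilProj p) = fun i => ((p i.castSucc : ℝ) : UnitAddCircle) := by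
  change (fun i : Fin 4 => ((coord (ofCoord p) i.castSucc : ℝ) : UnitAddCircle)) = _
  rw [coord_ofCoord]

/-- The point with coordinates `(x, s)`. -/
def fiberCoord : (Fin 4 → ℝ) × ℝ ≃ₜ E5 where
  toFun q := ![q.1 0, q.1 1, q.1 2, q.1 3, q.2]
  invFun p := (fun i => p i.castSucc, p 4)
  left_inv q := by
    refine Prod.ext (funext fun i => ?_) rfl
    fin_cases i <;> rfl
  right_inv p := by
    funext i
    fin_cases i <;> rfl
  continuous_toFun := by
    refine continuous_pi fun i => ?_
    fin_cases i <;> simp <;> fun_prop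
  continuous_invFun := by fun_prop

/-- Translation along the `z`-axis. -/
def zShift (s : ℝ) (p : E5) : E5 := ![p 0, p 1, p 2, p 3, p 4 + s]

/-- The `z`-axis is central in `H(2,1)`; therefore these shifts pass to the quotient. -/
theorem zShift_heisMul (s : ℝ) (g p : E5) : zShift s (heisMul g p) = heisMul g (zShift s p) := by
  funext k
  fin_cases k <;> simp [zShift, heisMul]
  ring

theorem zShift_add (s t : ℝ) (p : E5) : zShift (s + t) p = zShift s (zShift t p) := by
  funext k
  fin_cases k <;> simp [zShift]
  ring

theorem nilProj_zShift_int (n : ℤ) (p : E5) : nilProj (zShift n p) = nilProj p := by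
  refine nilProj_eq_iff.2 ⟨![0, 0, 0, 0, n], ?_⟩
  funext k
  fin_cases k <;> simp [zShift, heisMul, intVec]
  ring

/-- The action of the circle `ℝ/ℤ` on `N(2,1)` by translations of `z`. -/
def circleAct (t : UnitAddCircle) (q : N21) : N21 :=
  nilProj (zShift (QuotientAddGroup.mk_surjective t).choose (surjective_nilProj q).choose)

theorem coe_circle_eq_iff {x y : ℝ} :
    (x : UnitAddCircle) = (y : UnitAddCircle) ↔ ∃ n : ℤ, x = n + y := by
  rw [← sub_eq_zero, ← AddCircle.coe_sub, AddCircle.coe_eq_zero_iff]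
  refine exists_congr fun n => ?_
  rw [zsmul_one, eq_comm, sub_eq_iff_eq_add]

/-- The chosen representatives do not matter: integer shifts are lattice translations, and shifts
commute with the lattice. -/
theorem circleAct_coe (s : ℝ) (p : E5) :
    circleAct (s : UnitAddCircle) (nilProj p) = nilProj (zShift s p) := by
  have h1 := (QuotientAddGroup.mk_surjective (s : UnitAddCircle)).choose_spec
  have h2 := (surjective_nilProj (nilProj p)).choose_spec
  rw [circleAct]
  obtain ⟨n, hn⟩ := coe_circle_eq_iff.1 h1
  obtain ⟨m, hm⟩ := nilProj_eq_iff.1 h2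
  rw [hn, hm, zShift_add, nilProj_zShift_int, zShift_heisMul, nilProj_heisMul]

theorem continuous_circleAct : Continuous fun q : UnitAddCircle × N21 => circleAct q.1 q.2 := by
  have hq : IsOpenQuotientMap (Prod.map ((↑) : ℝ → UnitAddCircle) nilProj) :=
    QuotientAddGroup.isOpenQuotientMap_mk.prodMap isOpenQuotientMap_nilProj
  rw [hq.isQuotientMap.continuous_iff]
  have : (fun q : UnitAddCircle × N21 => circleAct q.1 q.2) ∘
      Prod.map ((↑) : ℝ → UnitAddCircle) nilProj = fun q => nilProj (zShift q.1 q.2) :=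
    funext fun q => circleAct_coe q.1 q.2
  rw [this]
  refine isCoveringMap_nilProj.continuous.comp (continuous_pi fun i => ?_)
  fin_cases i <;> simp [zShift] <;> fun_prop

theorem circleAct_zero (q : N21) : circleAct 0 q = q := by
  obtain ⟨p, rfl⟩ := surjective_nilProj q
  rw [← AddCircle.coe_zero, circleAct_coe]
  exact_mod_cast nilProj_zShift_int 0 p

theorem circleAct_add (s t : UnitAddCircle) (q : N21) :
    circleAct (s + t) q = circleAct s (circleAct t q) := by
  obtain ⟨p, rfl⟩ := surjective_nilProj q
  obtain ⟨s, rfl⟩ := QuotientAddGroup.mk_surjective s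
  obtain ⟨t, rfl⟩ := QuotientAddGroup.mk_surjective t
  change circleAct ((s : UnitAddCircle) + (t : UnitAddCircle)) _ = _
  rw [← AddCircle.coe_add, circleAct_coe, zShift_add, ← circleAct_coe, ← circleAct_coe]

theorem torusProj_circleAct (t : UnitAddCircle) (q : N21) :
    torusProj (circleAct t q) = torusProj q := by
  obtain ⟨p, rfl⟩ := surjective_nilProj q
  obtain ⟨t, rfl⟩ := QuotientAddGroup.mk_surjective t
  refine (congrArg torusProj (circleAct_coe t p)).trans ?_
  rw [torusProj_nilProj, torusProj_nilProj]
  funext i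
  fin_cases i <;> rfl

/-- The open unit box centred at `t`. -/
abbrev unitBox (t : Fin 4 → ℝ) : Set (Fin 4 → ℝ) :=
  Set.univ.pi fun i => Set.Ioo (t i - 1 / 2) (t i + 1 / 2)

theorem isOpen_unitBox (t : Fin 4 → ℝ) : IsOpen (unitBox t) :=
  isOpen_set_pi Set.finite_univ fun _ _ => isOpen_Ioo

theorem eq_of_mem_unitBox {t x y : Fin 4 → ℝ} (hx : x ∈ unitBox t) (hy : y ∈ unitBox t)
    {i : Fin 4} {n : ℤ} (h : x i = n + y i) : n = 0 := by
  have h1 := hx i (Set.mem_univ i)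
  have h2 := hy i (Set.mem_univ i)
  have : |(n : ℝ)| < 1 := abs_lt.2 ⟨by linarith [h1.1, h2.2], by linarith [h1.2, h2.1]⟩
  exact Int.abs_lt_one_iff.1 (by exact_mod_cast this)

/-- The projection `ℝ⁴ → T⁴`. -/
def torusCoe (x : Fin 4 → ℝ) : Fin 4 → UnitAddCircle := fun i => (x i : UnitAddCircle)

theorem isOpenMap_torusCoe : IsOpenMap torusCoe :=
  IsOpenMap.piMap (fun _ => QuotientAddGroup.isOpenMap_coe) (by simp)

theorem continuous_torusCoe : Continuous torusCoe :=
  continuous_pi fun i => continuous_quotient_mk'.comp (continuous_apply i)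

theorem torusCoe_injOn (t : Fin 4 → ℝ) : Set.InjOn torusCoe (unitBox t) := by
  intro x hx y hy h
  funext i
  obtain ⟨n, hn⟩ := coe_circle_eq_iff.1 (congrFun h i)
  rw [hn, eq_of_mem_unitBox hx hy hn]
  simp

/-- The local section of the circle bundle over a unit box, translated along the fibre. -/
def boxBundle (t : Fin 4 → ℝ) (q : unitBox t × UnitAddCircle) : N21 :=
  circleAct q.2 (nilProj (fiberCoord (q.1, 0)))

/-- The projection of the trivial bundle over a unit box to the trivial bundle over `T⁴`. -/
def boxTrivial (t : Fin 4 → ℝ) (q : unitBox t × UnitAddCircle) :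
    (Fin 4 → UnitAddCircle) × UnitAddCircle :=
  (torusCoe q.1, q.2)

theorem boxBundle_coe (t : Fin 4 → ℝ) (x : unitBox t) (s : ℝ) :
    boxBundle t (x, (s : UnitAddCircle)) = nilProj (fiberCoord (x, s)) := by
  rw [boxBundle, circleAct_coe]
  congr 1
  funext k
  fin_cases k <;> simp [zShift, fiberCoord]

theorem torusProj_fiberCoord (x : Fin 4 → ℝ) (s : ℝ) :
    torusProj (nilProj (fiberCoord (x, s))) = torusCoe x := by
  rw [torusProj_nilProj]
  funext i
  fin_cases i <;> rfl

theorem torusProj_boxBundle (t : Fin 4 → ℝ) (q : unitBox t × UnitAddCircle) :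
    torusProj (boxBundle t q) = torusCoe q.1 := by
  rw [boxBundle, torusProj_circleAct, torusProj_fiberCoord]

theorem isOpenEmbedding_boxTrivial (t : Fin 4 → ℝ) : Topology.IsOpenEmbedding (boxTrivial t) := by
  have h : Topology.IsOpenEmbedding fun x : unitBox t => torusCoe x :=
    .of_continuous_injective_isOpenMap (continuous_torusCoe.comp continuous_subtype_val)
      (fun x y hxy => Subtype.ext (torusCoe_injOn t x.2 y.2 hxy))
      (isOpenMap_torusCoe.comp (isOpen_unitBox t).isOpenMap_subtype_val)
  exact h.prodMap .id

theorem isOpenEmbedding_boxBundle (t : Fin 4 → ℝ) : Topology.IsOpenEmbedding (boxBundle t) := by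
  have hc : Continuous (boxBundle t) := by
    refine continuous_circleAct.comp (continuous_snd.prodMk
      (isCoveringMap_nilProj.continuous.comp (fiberCoord.continuous.comp ?_)))
    fun_prop
  have hq : IsOpenQuotientMap (Prod.map (id : unitBox t → unitBox t) ((↑) : ℝ → UnitAddCircle)) :=
    IsOpenQuotientMap.id.prodMap QuotientAddGroup.isOpenQuotientMap_mk
  refine .of_continuous_injective_isOpenMap hc ?_ ?_
  · rintro ⟨x, s⟩ ⟨y, r⟩ h
    have hxy : x = y := by
      refine Subtype.ext (torusCoe_injOn t x.2 y.2 ?_)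
      rw [← torusProj_boxBundle t (x, s), h, torusProj_boxBundle]
    subst hxy
    obtain ⟨s, rfl⟩ := QuotientAddGroup.mk_surjective s
    obtain ⟨r, rfl⟩ := QuotientAddGroup.mk_surjective r
    have h' := (boxBundle_coe t x s).symm.trans (h.trans (boxBundle_coe t x r))
    obtain ⟨n, hn⟩ := nilProj_eq_iff.1 h'
    -- With equal base coordinates the lattice element has no `x` component, so it causes no shear
    -- and the fibre parameters differ by an integer.
    have h0 : n 0 = 0 := by simpa [fiberCoord, heisMul] using congrFun hn 0
    have h2 : n 2 = 0 := by simpa [fiberCoord, heisMul] using congrFun hn 2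
    have h4 := congrFun hn 4
    simp [fiberCoord, heisMul, intVec, h0, h2] at h4
    exact Prod.ext rfl (coe_circle_eq_iff.2 ⟨n 4, h4⟩)
  · rw [hq.isOpenMap_iff]
    have : boxBundle t ∘ Prod.map id ((↑) : ℝ → UnitAddCircle) =
        nilProj ∘ fiberCoord ∘ Prod.map Subtype.val id :=
      funext fun q => boxBundle_coe t q.1 q.2
    rw [this]
    exact isCoveringMap_nilProj.isOpenMap.comp (fiberCoord.isOpenMap.comp
      ((isOpen_unitBox t).isOpenMap_subtype_val.prodMap IsOpenMap.id))

theorem range_boxBundle (t : Fin 4 → ℝ) :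
    Set.range (boxBundle t) = torusProj ⁻¹' (torusCoe '' unitBox t) := by
  ext q
  constructor
  · rintro ⟨q, rfl⟩
    exact ⟨q.1, q.1.2, (torusProj_boxBundle t q).symm⟩
  · rintro ⟨x, hx, h⟩
    obtain ⟨p, rfl⟩ := surjective_nilProj q
    rw [torusProj_nilProj] at h
    have h' : ∀ i : Fin 4, ∃ n : ℤ, x i = n + p i.castSucc := fun i =>
      coe_circle_eq_iff.1 (congrFun h i)
    choose n hn using h'
    -- This lattice element moves the base coordinates of `p` to `x`; whatever shear it produces in
    -- `z` becomes the fibre parameter.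
    set m : Fin 5 → ℤ := ![n 0, n 1, n 2, n 3, 0]
    refine ⟨(⟨x, hx⟩, (heisMul (intVec m) p 4 : ℝ)), ?_⟩
    rw [boxBundle_coe, ← nilProj_heisMul m p]
    congr 1
    funext k
    fin_cases k
    · exact hn 0
    · exact hn 1
    · exact hn 2
    · exact hn 3
    · rfl

theorem range_boxTrivial (t : Fin 4 → ℝ) :
    Set.range (boxTrivial t) = (torusCoe '' unitBox t) ×ˢ Set.univ := by
  ext ⟨b, s⟩
  constructor
  · rintro ⟨q, hq⟩
    rw [← hq]
    exact ⟨⟨q.1, q.1.2, rfl⟩, Set.mem_univ _⟩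
  · rintro ⟨⟨x, hx, rfl⟩, -⟩
    exact ⟨(⟨x, hx⟩, s), rfl⟩

theorem nonempty_unitBox (t : Fin 4 → ℝ) : Nonempty (unitBox t × UnitAddCircle) :=
  ⟨(⟨t, fun i _ => ⟨by linarith, by linarith⟩⟩, 0)⟩

/-- The trivialization of the circle bundle over a unit box. -/
def boxTrivialization (t : Fin 4 → ℝ) : Bundle.Trivialization UnitAddCircle torusProj :=
  haveI := nonempty_unitBox t
  { toOpenPartialHomeomorph :=
      ((isOpenEmbedding_boxBundle t).toOpenPartialHomeomorph (boxBundle t)).symm.trans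
        ((isOpenEmbedding_boxTrivial t).toOpenPartialHomeomorph (boxTrivial t))
    baseSet := torusCoe '' unitBox t
    open_baseSet := isOpenMap_torusCoe _ (isOpen_unitBox t)
    source_eq := by simp [← range_boxBundle]
    target_eq := by simp [← range_boxTrivial]
    proj_toFun := by
      intro q hq
      obtain ⟨x, rfl⟩ : q ∈ Set.range (boxBundle t) := by
        have hq' := hq.1
        simpa only [OpenPartialHomeomorph.symm_symm,
          Topology.IsOpenEmbedding.toOpenPartialHomeomorph_target] using hq'
      rw [torusProj_boxBundle]
      change torusCoe (((isOpenEmbedding_boxBundle t).toOpenPartialHomeomorph (boxBundle t)).symm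
        (boxBundle t x)).1 = _
      rw [Topology.IsOpenEmbedding.toOpenPartialHomeomorph_left_inv] }

theorem boxTrivialization_apply (t : Fin 4 → ℝ) (q : unitBox t × UnitAddCircle) :
    boxTrivialization t (boxBundle t q) = boxTrivial t q := by
  have := nonempty_unitBox t
  change boxTrivial t (((isOpenEmbedding_boxBundle t).toOpenPartialHomeomorph (boxBundle t)).symm
    (boxBundle t q)) = _
  rw [Topology.IsOpenEmbedding.toOpenPartialHomeomorph_left_inv]

theorem isPrincipalCircleBundle_torusProj : IsPrincipalCircleBundle torusProj := by
  refine ⟨circleAct, circleAct_zero, circleAct_add, continuous_circleAct, torusProj_circleAct,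
    fun b => ?_⟩
  choose t ht using fun i => QuotientAddGroup.mk_surjective (b i)
  refine ⟨boxTrivialization t, ⟨t, fun i _ => ⟨by linarith, by linarith⟩, funext ht⟩,
    fun s q hq => ?_⟩
  have hq' : q ∈ Set.range (boxBundle t) := by
    rw [range_boxBundle]
    exact hq
  obtain ⟨⟨x, r⟩, rfl⟩ := hq'
  have h : circleAct s (boxBundle t (x, r)) = boxBundle t (x, s + r) :=
    (circleAct_add s r _).symm
  rw [h, boxTrivialization_apply, boxTrivialization_apply]
  rfl

/-! ### Smooth structure and descent of left-invariant forms. -/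

theorem isLocalHomeomorph_nilProj : IsLocalHomeomorph nilProj :=
  isCoveringMap_nilProj.isLocalHomeomorph

/-- A local inverse of `nilProj` composed with `nilProj` is locally a lattice translation. -/
theorem contDiffAt_comp_nilProj (e : OpenPartialHomeomorph N21 E5)
    (he : ∀ x ∈ e.target, e.symm x = nilProj x) {p : E5} (hp : nilProj p ∈ e.source) :
    ContDiffAt ℝ ∞ (e ∘ nilProj) p := by
  have h : nilProj (e (nilProj p)) = nilProj p := by
    rw [← he _ (e.map_source hp), e.left_inv hp]
  obtain ⟨n, hn⟩ := nilProj_eq_iff.1 h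
  have hc := contDiff_heisMul (intVec n)
  refine hc.contDiffAt.congr_of_eventuallyEq ?_
  have hnhds : ∀ᶠ x in 𝓝 p, heisMul (intVec n) x ∈ e.target :=
    hc.continuous.continuousAt.eventually_mem (e.open_target.mem_nhds (hn ▸ e.map_source hp))
  filter_upwards [hnhds] with x hx
  rw [Function.comp_apply, ← nilProj_heisMul n x, ← he _ hx, e.right_inv hx]

/-- The smooth structure of `N(2,1)`, with the local inverses of `nilProj` as charts. -/
@[reducible]
def nilChartedSpace : ChartedSpace E5 N21 :=
  isLocalHomeomorph_nilProj.chartedSpace surjective_nilProj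

attribute [local instance] nilChartedSpace

/-- Together with `contDiffAt_comp_nilProj`, this makes every transition map locally a lattice
translation, hence smooth. -/
theorem symm_eq_nilProj_of_mem_atlas {e : OpenPartialHomeomorph N21 E5} (he : e ∈ atlas E5 N21) :
    ∀ x, e.symm x = nilProj x := by
  obtain ⟨q, rfl⟩ := he
  intro x
  simp [chartAt_self_eq]

theorem isManifold_N21 : IsManifold 𝓘(ℝ, E5) ∞ N21 := by
  refine isManifold_of_contDiffOn _ _ _ fun e e' he he' x hx => ?_
  have hx' : x ∈ (e.symm.trans e').source := hx.1
  have h1 := contDiffAt_comp_nilProj e' (fun x _ => symm_eq_nilProj_of_mem_atlas he' x) (p := x)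
    (by rw [← symm_eq_nilProj_of_mem_atlas he]; exact (e.symm.trans_source e' ▸ hx').2)
  refine ContDiffAt.contDiffWithinAt (h1.congr_of_eventuallyEq (Filter.Eventually.of_forall ?_))
  intro y
  change e' (e.symm y) = e' (nilProj y)
  rw [symm_eq_nilProj_of_mem_atlas he]

theorem contMDiff_nilProj : ContMDiff 𝓘(ℝ, E5) 𝓘(ℝ, E5) ∞ nilProj := by
  intro p
  refine contMDiffAt_iff.2 ⟨isCoveringMap_nilProj.continuous.continuousAt, ?_⟩
  refine ContDiffAt.contDiffWithinAt ?_
  exact contDiffAt_comp_nilProj (chartAt E5 (nilProj p))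
    (fun x _ => symm_eq_nilProj_of_mem_atlas (chart_mem_atlas _ _) x) (mem_chart_source _ _)

theorem contMDiffOn_localInverse (e : OpenPartialHomeomorph N21 E5)
    (he : ∀ x ∈ e.target, e.symm x = nilProj x) :
    ContMDiffOn 𝓘(ℝ, E5) 𝓘(ℝ, E5) ∞ e e.source := by
  intro q hq
  refine ContMDiffAt.contMDiffWithinAt (contMDiffAt_iff.2
    ⟨e.continuousAt hq, ContDiffAt.contDiffWithinAt ?_⟩)
  have hs := symm_eq_nilProj_of_mem_atlas (chart_mem_atlas E5 q)
  have h1 : nilProj (chartAt E5 q q) = q := by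
    rw [← hs, (chartAt E5 q).left_inv (mem_chart_source _ _)]
  refine (contDiffAt_comp_nilProj e he (p := chartAt E5 q q) (by rw [h1]; exact hq)).congr_of_eventuallyEq
    (Filter.Eventually.of_forall fun y => ?_)
  change e ((chartAt E5 q).symm y) = e (nilProj y)
  rw [hs]

theorem isLocalDiffeomorph_nilProj : IsLocalDiffeomorph 𝓘(ℝ, E5) 𝓘(ℝ, E5) ∞ nilProj := by
  intro p
  obtain ⟨φ, hp, hφ⟩ := isLocalHomeomorph_nilProj p
  refine ⟨{ φ.toPartialEquiv with
    open_source := φ.open_source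
    open_target := φ.open_target
    contMDiffOn_toFun := ?_
    contMDiffOn_invFun := ?_ }, hp, fun x _ => congrFun hφ x⟩
  · exact contMDiff_nilProj.contMDiffOn.congr fun x _ => (congrFun hφ x).symm
  · exact contMDiffOn_localInverse φ.symm fun x _ => (congrFun hφ x).symm

/-- The derivative of `nilProj`. -/
def nilDeriv (p : E5) : E5 ≃L[ℝ] E5 :=
  (isLocalDiffeomorph_nilProj p).mfderivToContinuousLinearEquiv (by simp)

theorem hasMFDerivAt_nilProj (p : E5) :
    HasMFDerivAt 𝓘(ℝ, E5) 𝓘(ℝ, E5) nilProj p (nilDeriv p : E5 →L[ℝ] E5) :=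
  (isLocalDiffeomorph_nilProj.mdifferentiable (by simp) p).hasMFDerivAt

/-- Chain rule for `nilProj ∘ L_n = nilProj`, comparing the derivatives at two lifts of one point.
-/
theorem nilDeriv_heisMul (n : Fin 5 → ℤ) (p u : E5) :
    nilDeriv (heisMul (intVec n) p) (fderiv ℝ (heisMul (intVec n)) p u) = nilDeriv p u := by
  have hm : HasMFDerivAt 𝓘(ℝ, E5) 𝓘(ℝ, E5) (heisMul (intVec n)) p
      (fderiv ℝ (heisMul (intVec n)) p) :=
    ((contDiff_heisMul (intVec n)).differentiable (by simp) p).hasFDerivAt.hasMFDerivAt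
  have h := (hasMFDerivAt_nilProj (heisMul (intVec n) p)).comp p hm
  -- The target tangent space depends on the map, so the equality of the two maps is substituted for
  -- a variable `f`.
  have hcongr : ∀ (f : E5 → N21) (L : E5 →L[ℝ] E5), f = nilProj →
      HasMFDerivAt 𝓘(ℝ, E5) 𝓘(ℝ, E5) f p L → HasMFDerivAt 𝓘(ℝ, E5) 𝓘(ℝ, E5) nilProj p L := by
    rintro _ L rfl h
    exact h
  have e : ((nilDeriv (heisMul (intVec n) p) : E5 →L[ℝ] E5).comp
      (fderiv ℝ (heisMul (intVec n)) p)) = nilDeriv p :=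
    hasMFDerivAt_unique (hcongr _ _ (funext (nilProj_heisMul n)) h) (hasMFDerivAt_nilProj p)
  exact congrArg (fun L : E5 →L[ℝ] E5 => L u) e

/-- The covector on `N(2,1)` induced by a left-invariant 1-form. -/
def descend (α : Form 1) (q : N21) : E5 →L[ℝ] ℝ :=
  (LinearMap.toContinuousLinearMap (covector (α (surjective_nilProj q).choose))).comp
    ((nilDeriv (surjective_nilProj q).choose).symm : E5 →L[ℝ] E5)

/-- Left invariance removes the dependence on the lift chosen in `descend`, since two lifts differ
by a lattice translation. -/
theorem descend_nilDeriv {α : Form 1}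
    (hα : ∀ (h : H21) p u, α (leftTrans h p) ![fderiv ℝ (leftTrans h) p u] = α p ![u])
    (p u : E5) : descend α (nilProj p) (nilDeriv p u) = α p ![u] := by
  obtain ⟨n, hn⟩ := nilProj_eq_iff.1 (surjective_nilProj (nilProj p)).choose_spec
  rw [descend, hn, ← nilDeriv_heisMul n p u]
  have hl : leftTrans (ofCoord (intVec n)) = heisMul (intVec n) := by
    rw [leftTrans_eq, coord_ofCoord]
  have := hα (ofCoord (intVec n)) p u
  rw [hl] at this
  rw [← this]
  change α _ ![(nilDeriv _).symm (nilDeriv _ _)] = _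
  rw [ContinuousLinearEquiv.symm_apply_apply]

theorem descendsToCompactNilmanifold {θ : Fin 5 → Form 1} (hθ : IsLeftInvariantCoframe θ) :
    DescendsToCompactNilmanifold θ :=
  ⟨compactSpace_N21, t2Space_N21, connectedSpace_N21, isCoveringMap_nilProj,
    isPrincipalCircleBundle_torusProj, nilChartedSpace, isManifold_N21,
    isLocalDiffeomorph_nilProj, fun i => descend (θ i),
    fun i p u => descend_nilDeriv (fun h => hθ.2.2 h i) p u⟩

end Heterotic

end

/-! ### The theorem. -/

open Heterotic in
theorem theorem4p3 (a b c l m t : ℝ) (hne : (l, m, t) ≠ (0, 0, 0))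
    (hlt : l ^ 2 + m ^ 2 + t ^ 2 < a ^ 2 + b ^ 2 + c ^ 2)
    (θ : Fin 5 → Form 1) (hθ : θ = coframe a b c)
    (F : Fin 3 → Form 2) (hF : F = su2Forms θ)
    (T : Form 3) (hT : T = torsionForm θ)
    (A : Conn (Fin 5)) (hA : A = instantonConn θ l m t)
    (α' : ℝ) (hα : α' = 2 / (a ^ 2 + b ^ 2 + c ^ 2 - l ^ 2 - m ^ 2 - t ^ 2)) :
    -- the compact nilmanifold and its left-invariant `SU(2)`-structure
    (IsLeftInvariantCoframe θ ∧ StructureEquations θ a b c ∧ DescendsToCompactNilmanifold θ ∧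
      IsSU2Structure (θ 4) F ∧ (∀ r, extDeriv (F r) = 0) ∧
      IsHorizontalASD θ (extDeriv (θ 4))) ∧
    -- the torsion connection
    (IsMetricWithTorsion θ (leviCivita θ) 0 ∧ IsMetricWithTorsion θ (plusConn θ T) T ∧
      IsParallel θ (plusConn θ T) (θ 4) ∧ ∀ r, IsParallel θ (plusConn θ T) (F r)) ∧
    -- the instanton
    ((∀ i j, A i j = -A j i) ∧ IsInstanton θ (F 0) A) ∧
    -- the first Pontrjagin forms
    (0 < α' ∧
      extDeriv T = (2 * Real.pi ^ 2 * α') • (pontrjagin (plusConn θ T) - pontrjagin A)) ∧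
    -- non-zero flux
    (∀ p, T p ≠ 0) ∧
    -- the heterotic system with flux `T` and constant dilaton
    (∀ φ₀ : ℝ,
      (∀ γ, IsCliffordRep γ → SupersymmetryEquations θ γ T (fun _ => φ₀) A) ∧
      AnomalyCancellation T α' (plusConn θ T) A ∧
      EquationsOfMotion θ T (fun _ => φ₀) α' (plusConn θ T) A) ∧
    -- the metric in the coordinates `(x₁, y₁, x₂, y₂, z)`
    ((a, b) ≠ (0, 0) → ∀ p u v : E5,
      metric θ p u v =
        (a ^ 2 + b ^ 2 + c ^ 2) ^ 2 * (u 0 * v 0)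
        + (a ^ 2 + b ^ 2 + c ^ 2) ^ 2 / (a ^ 2 + b ^ 2) * (u 2 * v 2)
        + (a ^ 2 + b ^ 2 + c ^ 2) * (u 1 * v 1)
        + (a ^ 2 + b ^ 2 + c ^ 2) * (a ^ 2 + b ^ 2) * (u 3 * v 3)
        + (a ^ 2 + b ^ 2 + c ^ 2) ^ 4 *
          ((p 0 * u 1 + p 2 * u 3 - u 4) * (p 0 * v 1 + p 2 * v 3 - v 4))) ∧
    ((a, b) = (0, 0) → ∀ p u v : E5,
      metric θ p u v =
        u 0 * v 0 + u 2 * v 2 + u 1 * v 1 + u 3 * v 3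
        + c ^ 2 * ((p 0 * u 1 + p 2 * u 3 - u 4) * (p 0 * v 1 + p 2 * v 3 - v 4))) := by
  subst hθ hF hT hA hα
  have habc : 0 < a ^ 2 + b ^ 2 + c ^ 2 := by nlinarith [sq_nonneg l, sq_nonneg m, sq_nonneg t]
  have h := isContactCoframe_coframe habc
  have hinv := isLeftInvariantCoframe_coframe habc
  refine ⟨⟨hinv, ⟨fun i hi => h.extDeriv_of_ne hi, h.structureEq⟩,
      descendsToCompactNilmanifold hinv, h.isSU2Structure, h.extDeriv_su2Forms,
      h.isHorizontalASD⟩,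
    ⟨h.isMetricWithTorsion_leviCivita, h.isMetricWithTorsion_plusConn, h.isParallel_eta,
      h.isParallel_su2Forms⟩,
    ⟨IsContactCoframe.instantonConn_skew l m t, h.isInstanton l m t⟩,
    ⟨div_pos two_pos (by linarith), h.extDeriv_torsionForm_eq hlt⟩,
    h.torsionForm_ne_zero habc,
    fun φ₀ => ⟨fun γ hγ => h.supersymmetryEquations hγ l m t φ₀, ?_,
      h.einsteinEquation hlt φ₀, h.fluxEquation φ₀, h.gaugeEquation l m t φ₀⟩,
    fun hab p u v => ?_, fun hab p u v => ?_⟩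
  -- The two normalizations agree: `(α'/4) · 8π² = 2π² α'`.
  · rw [AnomalyCancellation, h.extDeriv_torsionForm_eq hlt]
    congr 1
    ring
  · have hab' : ¬(a = 0 ∧ b = 0) := fun h0 => hab (by rw [h0.1, h0.2])
    rw [metric_coframe, metricCoeff_of_ne hab', Fin.sum_univ_five]
    simp
    ring
  · obtain ⟨rfl, rfl⟩ := Prod.mk.inj hab
    rw [metric_coframe, metricCoeff_zero, Fin.sum_univ_five]
    simp
    ring
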